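/- All rooted trees are finite. The \emph{children} $\mathrm{Ch}(u)$ of a vertex $u$ are its neighbours one level further from the root; a vertex with no children is a \emph{leaf}, the other vertices are \emph{internal}; \emph{siblings} are vertices with the same parent. $\mathcal T_u$ is the subtree formed by $u$ and its descendants (a single point if $u$ is a leaf). A homomorphism of rooted trees maps the root to the root, children of $u$ to children of the image of $u$, and leaves to leaves; $\varphi_u\colon\mathcal T_u\to\mathcal P_{\varphi(u)}$ is the restriction of $\varphi\colon\mathcal T\to\mathcal P$. Two maps $\varphi_j\colon\mathcal T_j\to\mathcal P_j$ ($j=1,2$) are \emph{equivalent} if $\omega\circ\varphi_1=\varphi_2\circ\tau$ for some isomorphisms $\tau\colon\mathcal T_1\to\mathcal T_2$, $\omega\colon\mathcal P_1\to\mathcal P_2$, and \emph{strictly equivalent} if $\mathcal P_1=\mathcal P_2$ and one can take $\omega=\mathrm{id}$. A \emph{$\mathcal P$-composition} of $\mathcal T$ is a surjective homomorphism $\varphi\colon\mathcal T\to\mathcal P$ such that $\varphi_u,\varphi_v$ are strictly equivalent whenever $u,v$ are internal siblings with $\varphi(u)=\varphi(v)$; $\mathsf C(\mathcal T,\mathcal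 P)$ is the set of all of them. The group $\mathrm{Aut}(\mathcal T)$ acts by $g\varphi=\varphi\circ g^{-1}$. Couples $(\varphi,\psi)$ and $(\varphi',\psi')$ of compositions of $\mathcal T$ and $\mathcal T'$ (with the same targets) are strictly equivalent if $\varphi=\varphi'\circ\zeta$ and $\psi=\psi'\circ\zeta$ for a single isomorphism $\zeta\colon\mathcal T\to\mathcal T'$. \emph{Quotient.} A quotient of $\varphi\in\mathsf C(\mathcal T,\mathcal P)$ is an $\alpha\in\mathsf C(\mathcal P,\mathcal Q)$ such that: (a) for every $x\in\mathcal P$, all the children of $x$ which are leaves are mapped by $\alpha$ to one vertex, which is the unique leaf among the children of $\alpha(x)$; (b) if $u,v\in\mathcal T$ are siblings and $\alpha(\varphi(u)),\alpha(\varphi(v))$ are distinct internal siblings, then $\varphi_u,\varphi_v$ are not equivalent; (c) if $u,w\in\mathcal T$ are internal and $\alpha(\varphi(u))=\alpha(\varphi(w))$, then $\varphi_u,\varphi_w$ are equivalent and $(\alpha\circ\varphi)_u,(\alpha\circ\varphi)_w$ are strictly equivalent. The associated \emph{tree of partitions} $(\Lambda,\mathcal Q)$ assigns to each non-root $b\in\mathcal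 Q$ the integer partition $\lambda^b$ whose parts are the numbers $|\varphi^{-1}(y)\cap\mathrm{Ch}(u)|$, $y\in\mathrm{Ch}(\varphi(u))\cap\alpha^{-1}(b)$, where $u$ is any vertex of $\mathcal T$ such that $\alpha(\varphi(u))$ is the parent of $b$. \emph{Transpose.} A transpose of $\varphi$ is a composition $\varphi^t\in\mathsf C(\mathcal T,\mathcal P^t)$, for some tree $\mathcal P^t$, with a quotient $\alpha^t\in\mathsf C(\mathcal P^t,\mathcal Q)$ such that $\alpha^t\circ\varphi^t=\alpha\circ\varphi$, the tree of partitions of $\varphi^t$ is $b\mapsto(\lambda^b)^t$ (conjugate partitions), and $|\varphi^{-1}(x)\cap(\varphi^t)^{-1}(y)|\le1$ for every internal $v\in\mathcal T$ and all $x\in\mathrm{Ch}(\varphi(v))$, $y\in\mathrm{Ch}(\varphi^t(v))$. \emph{Common refinements.} A common refinement of $(\varphi,\psi)\in\mathsf C(\mathcal T,\mathcal P)\times\mathsf C(\mathcal T,\mathcal M)$ is a composition $\rho\in\mathsf C(\mathcal T,\mathcal R)$ together with $\vartheta\in\mathsf C(\mathcal R,\mathcal P)$ and $\tau\in\mathsf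 C(\mathcal R,\mathcal M)$ such that $\vartheta\circ\rho=\varphi$, $\tau\circ\rho=\psi$. A common refinement $(\rho,\vartheta,\tau)$ of $(\varphi,\psi)$ and a common refinement $(\rho',\vartheta',\tau')$ of $(\varphi',\psi')$ are equivalent if there are isomorphisms $\zeta\colon\mathcal T\to\mathcal T'$ and $\gamma\colon\mathcal R\to\mathcal R'$ with $\gamma\circ\rho=\rho'\circ\zeta$, $\varphi=\varphi'\circ\zeta$, $\psi=\psi'\circ\zeta$, $\vartheta=\vartheta'\circ\gamma$, $\tau=\tau'\circ\gamma$. The refinement is the \emph{coarsest} one if, whenever $u,v\in\mathcal T$ are such that $\rho(u),\rho(v)$ are distinct siblings with the same image under $\vartheta$ and the same image under $\tau$, the restricted common refinements $\rho_u$ of $(\varphi_u,\psi_u)$ and $\rho_v$ of $(\varphi_v,\psi_v)$ are not equivalent. It is \emph{trivial} if $\rho$ is an isomorphism. \textbf{Theorem.} Let $\varphi\in\mathsf C(\mathcal T,\mathcal P)$ have quotient $\alpha\in\mathsf C(\mathcal P,\mathcal Q)$ and associated tree of partitions $(\Lambda,\mathcal Q)$, and let $\varphi^t\in\mathsf C(\mathcal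 T,\mathcal P^t)$ be a transpose of $\varphi$. Suppose that $\psi\in\mathsf C(\mathcal T,\mathcal P^t)$ is strictly equivalent to $\varphi^t$ and that the coarsest common refinement $\rho\colon\mathcal T\to\mathcal R$ of $(\varphi,\psi)$ is trivial. Then there exists $g\in\mathrm{Aut}(\mathcal T)$ such that \[ g\varphi=\varphi\qquad\text{and}\qquad g\varphi^t=\psi. \] In particular, the couples $(\varphi,\psi)$ and $(\varphi,\varphi^t)$ are strictly equivalent, and a coarsest common refinement of $(\varphi,\varphi^t)$ exists and every such refinement is equivalent to $\rho$. -/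

import Mathlib

universe uT uP uPt uQ uR uS

/-!
Rooted trees are Mathlib's `RootedTree`s: the order is the ancestor order (`u ≤ v` iff `u` is an
ancestor of `v` or `u = v`), the root is `⊥`, and `u ⋖ v` says that `v` is a child of `u`.
The subtree `T_u` is `Set.Ici u`, and for a leaf `u` it is the one-point tree.  Isomorphisms of
rooted trees are order isomorphisms; `T ≃o T` is the automorphism group.  The definitions below
only need the partial order and the root, so that they apply verbatim to the subtrees `Set.Ici u`.
-/

namespace TreeComposition

section Trees

variable {T : Type*} [PartialOrder T]

/-- A vertex is internal if it has at least one child. -/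
def Internal (u : T) : Prop := ∃ w, u ⋖ w

/-- A leaf is a vertex without children. -/
def IsLeaf (u : T) : Prop := ∀ w, ¬ u ⋖ w

/-- Two vertices are siblings if they have the same parent. -/
def Siblings (u v : T) : Prop := ∃ p, p ⋖ u ∧ p ⋖ v

end Trees

section Restrictions

variable {T P : Type*} [PartialOrder T] [PartialOrder P]

/-- The map `φ_u : T_u → P_{φ(u)}`, restriction of `φ : T → P`. -/
def restrict (φ : T →o P) (u : T) : Set.Ici u →o Set.Ici (φ u) where
  toFun w := ⟨φ w, φ.monotone w.2⟩
  monotone' _ _ h := φ.monotone h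

/-- The restriction `φ_u` of `φ : T → P` to `T_u`, seen as a map into the whole of `P`.
It is used to compare `φ_u` and `φ_v` when the targets `P_{φ(u)}` and `P_{φ(v)}` coincide. -/
def onSubtree (φ : T →o P) (u : T) : Set.Ici u →o P where
  toFun w := φ w
  monotone' _ _ h := φ.monotone h

/-- The action `g φ = φ ∘ g⁻¹` of `Aut(T)`. -/
def act (g : T ≃o T) (φ : T →o P) : T →o P where
  toFun w := φ (g.symm w)
  monotone' _ _ h := φ.monotone (g.symm.monotone h)

end Restrictions

section Equivalences

variable {T₁ T₂ P₁ P₂ P M : Type*} [PartialOrder T₁] [PartialOrder T₂]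
  [PartialOrder P₁] [PartialOrder P₂] [PartialOrder P] [PartialOrder M]

/-- `φ₁ : T₁ → P₁` and `φ₂ : T₂ → P₂` are equivalent: `ω ∘ φ₁ = φ₂ ∘ τ` for isomorphisms `τ, ω`. -/
def Equivalent (φ₁ : T₁ →o P₁) (φ₂ : T₂ →o P₂) : Prop :=
  ∃ (τ : T₁ ≃o T₂) (ω : P₁ ≃o P₂), ∀ w, ω (φ₁ w) = φ₂ (τ w)

/-- `φ₁ : T₁ → P` and `φ₂ : T₂ → P` are strictly equivalent: `φ₁ = φ₂ ∘ τ` for an isomorphism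
`τ`. -/
def StrictlyEquivalent (φ₁ : T₁ →o P) (φ₂ : T₂ →o P) : Prop :=
  ∃ τ : T₁ ≃o T₂, ∀ w, φ₁ w = φ₂ (τ w)

/-- The couples `(φ₁, ψ₁)` and `(φ₂, ψ₂)` are strictly equivalent: `φ₁ = φ₂ ∘ ζ` and
`ψ₁ = ψ₂ ∘ ζ` for one and the same isomorphism `ζ`. -/
def PairStrictlyEquivalent (φ₁ : T₁ →o P) (ψ₁ : T₁ →o M) (φ₂ : T₂ →o P) (ψ₂ : T₂ →o M) : Prop :=
  ∃ ζ : T₁ ≃o T₂, (∀ w, φ₁ w = φ₂ (ζ w)) ∧ (∀ w, ψ₁ w = ψ₂ (ζ w))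

end Equivalences

section Compositions

variable {T P M Q R : Type*} [PartialOrder T] [OrderBot T] [PartialOrder P] [OrderBot P]
  [PartialOrder M] [OrderBot M] [PartialOrder Q] [OrderBot Q] [PartialOrder R] [OrderBot R]

/-- `φ` is a `P`-composition of `T`: a surjective homomorphism of rooted trees (it maps the root to
the root, children to children, leaves to leaves) that satisfies the regularity condition.
An isomorphism `T_u ≃ T_v` between the subtrees of two siblings is the same as the restriction of
an automorphism of `T` that maps `u` to `v`. -/
structure IsComposition (φ : T →o P) : Prop where
  map_bot : φ ⊥ = ⊥
  map_child : ∀ u v, u ⋖ v → φ u ⋖ φ v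
  map_leaf : ∀ u, IsLeaf u → IsLeaf (φ u)
  surjective : Function.Surjective φ
  regular : ∀ u v, Siblings u v → Internal u → Internal v → φ u = φ v →
    StrictlyEquivalent (onSubtree φ u) (onSubtree φ v)

/-- `α : P → Q` is a quotient of the tree composition `φ : T → P`. -/
structure IsQuotient (φ : T →o P) (α : P →o Q) : Prop where
  isComposition : IsComposition α
  /-- The children of `x` that are leaves are all mapped to the unique child of `α(x)` that is a
  leaf. -/
  leaves : ∀ x y, x ⋖ y → IsLeaf y → IsLeaf (α y) ∧ ∀ b, α x ⋖ b → IsLeaf b → b = α y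
  not_equivalent : ∀ u v, Siblings u v → Siblings (α (φ u)) (α (φ v)) → α (φ u) ≠ α (φ v) →
    Internal (α (φ u)) → Internal (α (φ v)) → ¬ Equivalent (restrict φ u) (restrict φ v)
  equivalent : ∀ u w, Internal u → Internal w → α (φ u) = α (φ w) →
    Equivalent (restrict φ u) (restrict φ w) ∧
      StrictlyEquivalent (onSubtree (α.comp φ) u) (onSubtree (α.comp φ) w)

/-- For `a = α(φ(u))` and a child `b` of `a`: the type of the partition of
`(α ∘ φ)⁻¹(b) ∩ Ch(u)` into the parts `φ⁻¹(y) ∩ Ch(u)`, `y ∈ Ch(φ(u)) ∩ α⁻¹(b)`, as the multiset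
of the cardinalities of the parts. -/
noncomputable def partitionAt [Finite P] (φ : T →o P) (α : P →o Q) (u : T) (b : Q) : Multiset ℕ :=
  (Set.toFinite {y : P | φ u ⋖ y ∧ α y = b}).toFinset.val.map
    fun y => Set.ncard {w : T | u ⋖ w ∧ φ w = y}

/-- `(Λ, Q)` is the tree of partitions associated to `φ` and its quotient `α`.  An integer partition
is encoded by its Young diagram, whose row lengths are its parts; conjugation of partitions is
transposition of diagrams.  The root of `Q` carries no partition: the value of `Λ` there is
irrelevant. -/
def IsTreeOfPartitions [Finite P] (φ : T →o P) (α : P →o Q) (Λ : Q → YoungDiagram) : Prop :=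
  ∀ u b, α (φ u) ⋖ b → ((Λ b).rowLens : Multiset ℕ) = partitionAt φ α u b

/-- `φ` and `ψ` have `0-1` intersection: `|φ⁻¹(x) ∩ ψ⁻¹(y)| ≤ 1` for all internal `v`,
`x ∈ Ch(φ(v))`, `y ∈ Ch(ψ(v))`. -/
def ZeroOneIntersection (φ : T →o P) (ψ : T →o M) : Prop :=
  ∀ v x y, Internal v → φ v ⋖ x → ψ v ⋖ y → {w | φ w = x ∧ ψ w = y}.encard ≤ 1

/-- `φt` is a transpose of `φ`, where `α` is the quotient of `φ` and `(Λ, Q)` is the associated tree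
of partitions. -/
def IsTranspose [Finite P] [Finite M] (φ : T →o P) (α : P →o Q) (Λ : Q → YoungDiagram)
    (φt : T →o M) : Prop :=
  IsQuotient φ α ∧ IsTreeOfPartitions φ α Λ ∧ IsComposition φt ∧
    (∃ αt : M →o Q, IsQuotient φt αt ∧ αt.comp φt = α.comp φ ∧
      IsTreeOfPartitions φt αt (fun b => (Λ b).transpose)) ∧
    ZeroOneIntersection φ φt

/-- `ρ : T → R`, together with `θ : R → P` and `τ : R → M`, is a common refinement of `(φ, ψ)`. -/
structure IsCommonRefinement (φ : T →o P) (ψ : T →o M) (ρ : T →o R) (θ : R →o P) (τ : R →o M) :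
    Prop where
  comp_ρ : IsComposition ρ
  comp_θ : IsComposition θ
  comp_τ : IsComposition τ
  comm_left : θ.comp ρ = φ
  comm_right : τ.comp ρ = ψ

end Compositions

section Refinements

/-- The common refinements `(ρ₁, θ₁, τ₁)` of `(φ₁, ψ₁)` and `(ρ₂, θ₂, τ₂)` of `(φ₂, ψ₂)` are
equivalent. -/
def RefinementsEquivalent {T₁ T₂ R₁ R₂ P M : Type*} [PartialOrder T₁] [PartialOrder T₂]
    [PartialOrder R₁] [PartialOrder R₂] [PartialOrder P] [PartialOrder M]
    (φ₁ : T₁ →o P) (ψ₁ : T₁ →o M) (ρ₁ : T₁ →o R₁) (θ₁ : R₁ →o P) (τ₁ : R₁ →o M)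
    (φ₂ : T₂ →o P) (ψ₂ : T₂ →o M) (ρ₂ : T₂ →o R₂) (θ₂ : R₂ →o P) (τ₂ : R₂ →o M) : Prop :=
  ∃ (ζ : T₁ ≃o T₂) (γ : R₁ ≃o R₂),
    (∀ w, γ (ρ₁ w) = ρ₂ (ζ w)) ∧
    (∀ w, φ₁ w = φ₂ (ζ w)) ∧ (∀ w, ψ₁ w = ψ₂ (ζ w)) ∧
    (∀ a, θ₁ a = θ₂ (γ a)) ∧ (∀ a, τ₁ a = τ₂ (γ a))

variable {T P M R : Type*} [PartialOrder T] [OrderBot T] [PartialOrder P] [OrderBot P]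
  [PartialOrder M] [OrderBot M] [PartialOrder R] [OrderBot R]

/-- `(ρ, θ, τ)` is the coarsest common refinement of `(φ, ψ)`: a common refinement with the
coarseness condition.  If `ρ(u)`, `ρ(v)` are leaves then all the subtrees involved are points, and
the condition says that `θ(ρ(u)) = θ(ρ(v))` and `τ(ρ(u)) = τ(ρ(v))` cannot hold together. -/
structure IsCoarsestCommonRefinement (φ : T →o P) (ψ : T →o M) (ρ : T →o R) (θ : R →o P)
    (τ : R →o M) : Prop where
  isCommonRefinement : IsCommonRefinement φ ψ ρ θ τ
  coarse : ∀ u v, Siblings (ρ u) (ρ v) → ρ u ≠ ρ v →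
    θ (ρ u) = θ (ρ v) → τ (ρ u) = τ (ρ v) →
    ¬ RefinementsEquivalent
      (onSubtree φ u) (onSubtree ψ u) (restrict ρ u) (onSubtree θ (ρ u)) (onSubtree τ (ρ u))
      (onSubtree φ v) (onSubtree ψ v) (restrict ρ v) (onSubtree θ (ρ v)) (onSubtree τ (ρ v))

/-- `ρ` is trivial if it is an isomorphism of rooted trees. -/
def IsTrivial (ρ : T →o R) : Prop := ∃ e : T ≃o R, ∀ w, e w = ρ w

end Refinements

end TreeComposition

/-! Write `ψ = φt ∘ σ` with `σ` an automorphism of `T`. Triviality of the coarsest refinement makes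
`(φ, φt ∘ σ)` rigid: distinct siblings never carry isomorphic subtrees labelled by both maps. The
0-1 intersection makes `(φ, φt)` rigid as well. So it suffices to show that two rigid pairs differ
by an automorphism, `exists_iso_of_rigid`.

This goes by induction on the size of the subtree at `u`, proving two claims together
(`equivalent_and_labelIso_of_rigid`): (A) `φ_u` and `φ_{σ u}` are equivalent; (B) if `φ` agrees at
`u`, `u'` and `φt ∘ σ` at `u` agrees with `φt ∘ σ'` at `u'`, then the doubly labelled subtrees are
isomorphic. Put the children of `u` into a table with rows given by `φ` and columns by `φt ∘ σ`.
Rigidity and (B) below `u` leave at most one child per cell; (A) below `u` makes a row meet columns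
of one type only, the type being the value of `β`. Counting pairs within a row bounds the sum of
squared row lengths by the sum of `min(c_j, c_k)` over pairs of columns of equal type. The
partitions at `σ u` being conjugate, this bound is the sum of squared row lengths at `σ u`. Since
`σ` permutes the vertices with subtrees of a given size, all these inequalities are equalities, and
equality forces the columns of each type to be nested. A nested 0-1 table is determined by its
column sums up to renaming rows (the uniqueness half of Gale-Ryser), so rows at `u` match rows at `σ
u`, giving (A), and children at `u` match children at `u'`, giving (B). -/

set_option linter.unusedSectionVars false

namespace TreeComposition

/-! ### Parents and children in the ancestor order. -/

section TreeOrder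

variable {T : Type*} [PartialOrder T]

theorem le_or_le_of_le [PredOrder T] [IsPredArchimedean T] {a b r : T} (ha : a ≤ r)
    (hb : b ≤ r) : a ≤ b ∨ b ≤ a :=
  le_total_of_directed hb ha

theorem parent_unique [PredOrder T] {p q u : T} (hp : p ⋖ u) (hq : q ⋖ u) : p = q := by
  have h1 : q ≤ Order.pred u := Order.le_pred_of_lt hq.lt
  have h2 : p ≤ Order.pred u := Order.le_pred_of_lt hp.lt
  have key : ∀ r : T, r ⋖ u → r ≤ Order.pred u → r = Order.pred u := by
    intro r hr hle
    by_contra hne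
    refine hr.2 (lt_of_le_of_ne hle hne) (lt_of_le_of_ne (Order.pred_le u) fun h => ?_)
    exact (Order.min_of_le_pred h.ge).not_lt hr.lt
  rw [key p hp h2, key q hq h1]

theorem child_unique [PredOrder T] [IsPredArchimedean T] {u v v' x : T} (hv : u ⋖ v)
    (hv' : u ⋖ v') (h : v ≤ x) (h' : v' ≤ x) : v = v' := by
  by_contra hne
  rcases le_or_le_of_le h h' with hl | hl
  · exact hv'.2 hv.lt (lt_of_le_of_ne hl hne)
  · exact hv.2 hv'.lt (lt_of_le_of_ne hl (Ne.symm hne))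

theorem exists_child_le [Finite T] {u x : T} (h : u < x) : ∃ v, u ⋖ v ∧ v ≤ x :=
  exists_covBy_le_of_lt h

theorem exists_parent [Finite T] [OrderBot T] {u : T} (h : u ≠ ⊥) : ∃ p, p ⋖ u := by
  obtain ⟨p, -, hp⟩ := exists_le_covBy_of_lt (bot_lt_iff_ne_bot.2 h)
  exact ⟨p, hp⟩

theorem IsLeaf.eq_of_le [Finite T] {u x : T} (hu : IsLeaf u) (h : u ≤ x) : x = u := by
  by_contra hne
  obtain ⟨v, hv, -⟩ := exists_child_le (lt_of_le_of_ne h (Ne.symm hne))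
  exact hu v hv

theorem isLeaf_or_internal (u : T) : IsLeaf u ∨ Internal u := by
  by_cases h : Internal u
  · exact Or.inr h
  · exact Or.inl fun w hw => h ⟨w, hw⟩

theorem Internal.not_isLeaf {u : T} (h : Internal u) : ¬ IsLeaf u := by
  obtain ⟨w, hw⟩ := h
  exact fun h' => h' w hw

/-- The finite set of children of a vertex. -/
noncomputable def children [Finite T] (u : T) : Finset T := (Set.toFinite {v | u ⋖ v}).toFinset

@[simp] theorem mem_children [Finite T] {u v : T} : v ∈ children u ↔ u ⋖ v := by
  simp [children]

theorem card_Ici_lt [Finite T] {u v : T} (h : u ⋖ v) :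
    Nat.card (Set.Ici v) < Nat.card (Set.Ici u) := by
  rw [Nat.card_coe_set_eq, Nat.card_coe_set_eq]
  refine Set.ncard_lt_ncard ?_ (Set.toFinite _)
  exact Set.Ici_ssubset_Ici.2 h.lt

end TreeOrder

/-! ### Isomorphisms of subtrees: restriction and gluing. -/

section SubtreeIsomorphisms

variable {T T' : Type*} [PartialOrder T] [PartialOrder T']

theorem subtreeIso_root {u : T} {u' : T'} (h : Set.Ici u ≃o Set.Ici u') :
    (h ⟨u, le_rfl⟩ : T') = u' := congrArg Subtype.val (h.map_bot)

theorem subtreeIso_covBy {u : T} {u' : T'} (h : Set.Ici u ≃o Set.Ici u') {x y : Set.Ici u}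
    (hxy : (x : T) ⋖ y) : (h x : T') ⋖ h y := by
  refine ⟨h.strictMono hxy.lt, fun c hc hc' => ?_⟩
  have hcu : u' ≤ c := le_trans (h x).2 hc.le
  have h1 : x < h.symm ⟨c, hcu⟩ := by rw [h.lt_symm_apply]; exact hc
  have h2 : h.symm ⟨c, hcu⟩ < y := by rw [h.symm_apply_lt]; exact hc'
  exact hxy.2 h1 h2

theorem subtreeIso_child {u v : T} {u' : T'} (h : Set.Ici u ≃o Set.Ici u') (hv : u ⋖ v) :
    u' ⋖ (h ⟨v, hv.le⟩ : T') := by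
  have := subtreeIso_covBy h (x := ⟨u, le_rfl⟩) (y := ⟨v, hv.le⟩) hv
  rwa [subtreeIso_root] at this

/-- An isomorphism of subtrees restricts to the subtrees of corresponding vertices. -/
def subtreeIsoRestrict {u : T} {u' : T'} (h : Set.Ici u ≃o Set.Ici u') (x : Set.Ici u) :
    Set.Ici (x : T) ≃o Set.Ici (h x : T') where
  toFun y := ⟨h ⟨y, le_trans x.2 y.2⟩, h.monotone y.2⟩
  invFun y := ⟨h.symm ⟨y, le_trans (h x).2 y.2⟩, by
    have : x ≤ h.symm ⟨y, le_trans (h x).2 y.2⟩ := by rw [h.le_symm_apply]; exact y.2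
    exact this⟩
  left_inv y := by
    have := congrArg Subtype.val (h.symm_apply_apply ⟨y.1, le_trans x.2 y.2⟩)
    exact Subtype.ext this
  right_inv y := by
    have := congrArg Subtype.val (h.apply_symm_apply ⟨y.1, le_trans (h x).2 y.2⟩)
    exact Subtype.ext this
  map_rel_iff' {a b} := by
    change h _ ≤ h _ ↔ _
    rw [h.le_iff_le]
    rfl

/-- The isomorphism from the subtree at `u` to the subtree at `e u` induced by an isomorphism. -/
def subtreeIsoOfIso (e : T ≃o T') (u : T) : Set.Ici u ≃o Set.Ici (e u) where
  toFun y := ⟨e y, e.monotone y.2⟩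
  invFun y := ⟨e.symm y, by rw [Set.mem_Ici, e.le_symm_apply]; exact y.2⟩
  left_inv y := by simp
  right_inv y := by simp
  map_rel_iff' {a b} := by
    change e _ ≤ e _ ↔ _
    rw [e.le_iff_le]
    rfl

/-- The subtree of a leaf is a single point. -/
theorem leaf_subsingleton [Finite T] {u : T} (hu : IsLeaf u) (x : Set.Ici u) :
    x = ⟨u, le_rfl⟩ := Subtype.ext (hu.eq_of_le x.2)

theorem subtreeIso_isLeaf [Finite T] {u : T} {u' : T'} (h : Set.Ici u ≃o Set.Ici u') (hu : IsLeaf u) :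
    IsLeaf u' := by
  intro w hw
  have := subtreeIso_child h.symm hw
  exact hu _ this

theorem card_Ici_congr {u : T} {u' : T'} (h : Set.Ici u ≃o Set.Ici u') :
    Nat.card (Set.Ici u) = Nat.card (Set.Ici u') := Nat.card_congr h.toEquiv

section Glue

variable [PredOrder T] [IsPredArchimedean T] [Finite T]
  [PredOrder T'] [IsPredArchimedean T'] [Finite T']

/-- Isomorphisms between the subtrees of the children of two vertices, along a bijection between
these children, can be glued together. -/
theorem exists_subtreeIso_glue {u : T} {u' : T'} (e : {v // u ⋖ v} ≃ {v' // u' ⋖ v'})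
    (h : ∀ v, Set.Ici v.1 ≃o Set.Ici (e v).1) :
    ∃ H : Set.Ici u ≃o Set.Ici u', ∀ (v : {v // u ⋖ v}) (x : Set.Ici v.1),
      (H ⟨x, le_trans v.2.le x.2⟩).1 = (h v x).1 := by
  classical
  have hch : ∀ x : Set.Ici u, (x : T) ≠ u → ∃ v : {v // u ⋖ v}, v.1 ≤ x := by
    intro x hx
    obtain ⟨v, hv, hvx⟩ := exists_child_le (lt_of_le_of_ne x.2 (Ne.symm hx))
    exact ⟨⟨v, hv⟩, hvx⟩
  choose c hc using hch
  have hcu : ∀ (v : {v // u ⋖ v}) (x : Set.Ici u) (hx : (x : T) ≠ u), v.1 ≤ x → c x hx = v := by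
    intro v x hx hvx
    exact Subtype.ext (child_unique (c x hx).2 v.2 (hc x hx) hvx)
  -- `c x hx` is the unique child of `u` weakly below `x` in the order; it selects the isomorphism
  -- to apply.
  let F : Set.Ici u → Set.Ici u' := fun x =>
    if hx : (x : T) = u then ⟨u', le_rfl⟩
    else ⟨h (c x hx) ⟨x, hc x hx⟩, le_trans (e (c x hx)).2.le (h (c x hx) ⟨x, hc x hx⟩).2⟩
  have hF0 : ∀ x : Set.Ici u, (x : T) = u → (F x : T') = u' := by
    intro x hx
    simp [F, hx]
  have hF1 : ∀ (v : {v // u ⋖ v}) (x : Set.Ici u) (hvx : v.1 ≤ x), (F x : T') = h v ⟨x, hvx⟩ := by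
    intro v x hvx
    have hx : (x : T) ≠ u := (lt_of_lt_of_le v.2.lt hvx).ne'
    have := hcu v x hx hvx
    subst this
    simp [F, hx]
  have hF2 : ∀ (v : {v // u ⋖ v}) (x : Set.Ici u), v.1 ≤ x → (e v).1 ≤ F x := by
    intro v x hvx
    rw [hF1 v x hvx]
    exact (h v ⟨x, hvx⟩).2
  have hle : ∀ x y, F x ≤ F y ↔ x ≤ y := by
    intro x y
    by_cases hx : (x : T) = u
    · have h1 : F x ≤ F y := by
        change (F x : T') ≤ F y
        rw [hF0 x hx]; exact (F y).2
      have h2 : x ≤ y := by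
        change (x : T) ≤ y
        rw [hx]; exact y.2
      exact iff_of_true h1 h2
    · have hxv := hc x hx
      by_cases hy : (y : T) = u
      · refine iff_of_false (fun hle => ?_) (fun hle => ?_)
        · have h1 : (F x : T') ≤ u' := (show (F x : T') ≤ F y from hle).trans (hF0 y hy).le
          exact absurd (lt_of_lt_of_le (e (c x hx)).2.lt (hF2 _ x hxv)) h1.not_gt
        · have h1 : (x : T) ≤ u := (show (x : T) ≤ y from hle).trans hy.le
          exact hx (le_antisymm h1 x.2)
      · have hyv := hc y hy
        have same : c x hx = c y hy → (F x ≤ F y ↔ x ≤ y) := by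
          intro hcc
          have hyv' : (c x hx).1 ≤ y := by rw [hcc]; exact hyv
          change (F x : T') ≤ F y ↔ _
          rw [hF1 _ x hxv, hF1 _ y hyv']
          change h (c x hx) _ ≤ h (c x hx) _ ↔ _
          rw [(h (c x hx)).le_iff_le]
          rfl
        constructor
        · intro hle
          refine (same ?_).1 hle
          apply e.injective
          apply Subtype.ext
          exact child_unique (e (c x hx)).2 (e (c y hy)).2 (x := (F y : T'))
            (le_trans (hF2 _ x hxv) hle) (hF2 _ y hyv)
        · intro hle
          refine (same ?_).2 hle
          exact (hcu (c x hx) y hy (le_trans hxv hle)).symm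
  have hsurj : Function.Surjective F := by
    intro y
    by_cases hy : (y : T') = u'
    · refine ⟨⟨u, le_rfl⟩, Subtype.ext ?_⟩
      rw [hF0 _ rfl, hy]
    · obtain ⟨w, hw, hwy⟩ := exists_child_le (lt_of_le_of_ne y.2 (Ne.symm hy))
      obtain ⟨v, hv⟩ := e.surjective ⟨w, hw⟩
      have hwy' : (e v).1 ≤ y := by rw [hv]; exact hwy
      refine ⟨⟨(h v).symm ⟨y, hwy'⟩, le_trans v.2.le ((h v).symm ⟨y, hwy'⟩).2⟩, Subtype.ext ?_⟩
      refine (hF1 v ⟨(h v).symm ⟨y, hwy'⟩, _⟩ ((h v).symm ⟨y, hwy'⟩).2).trans ?_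
      simp
  refine ⟨RelIso.ofSurjective (OrderEmbedding.ofMapLEIff F hle) hsurj, fun v x => ?_⟩
  exact hF1 v ⟨x, le_trans v.2.le x.2⟩ x.2

end Glue

end SubtreeIsomorphisms

/-! ### Isomorphisms of labelled trees, with arbitrary labels. -/

section LabelIso

/-- The subtrees at `u` and `u'`, with vertices labelled by `L` and `L'`, are isomorphic as labelled
trees. -/
def LabelIso {T T' X : Type*} [PartialOrder T] [PartialOrder T'] (L : T → X) (L' : T' → X)
    (u : T) (u' : T') : Prop :=
  ∃ h : Set.Ici u ≃o Set.Ici u', ∀ x : Set.Ici u, L x = L' (h x)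

variable {T T' T'' X : Type*} [PartialOrder T] [PartialOrder T'] [PartialOrder T'']
  {L : T → X} {L' : T' → X} {L'' : T'' → X} {u : T} {u' : T'} {u'' : T''}

theorem LabelIso.refl (L : T → X) (u : T) : LabelIso L L u u := ⟨OrderIso.refl _, fun _ => rfl⟩

theorem LabelIso.trans (h : LabelIso L L' u u') (h' : LabelIso L' L'' u' u'') :
    LabelIso L L'' u u'' := by
  obtain ⟨h, hh⟩ := h
  obtain ⟨k, hk⟩ := h'
  exact ⟨h.trans k, fun x => by rw [hh, hk]; simp⟩

theorem LabelIso.label_eq (h : LabelIso L L' u u') : L u = L' u' := by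
  obtain ⟨h, hh⟩ := h
  have := hh ⟨u, le_rfl⟩
  rwa [subtreeIso_root] at this

theorem LabelIso.exists_child (h : LabelIso L L' u u') {v : T} (hv : u ⋖ v) :
    ∃ v', u' ⋖ v' ∧ LabelIso L L' v v' := by
  obtain ⟨h, hh⟩ := h
  refine ⟨h ⟨v, hv.le⟩, subtreeIso_child h hv, subtreeIsoRestrict h ⟨v, hv.le⟩, fun x => ?_⟩
  exact hh ⟨x, le_trans hv.le x.2⟩

theorem LabelIso.glue [PredOrder T] [IsPredArchimedean T] [Finite T]
    [PredOrder T'] [IsPredArchimedean T'] [Finite T'] (hL : L u = L' u')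
    (e : {v // u ⋖ v} ≃ {v' // u' ⋖ v'}) (h : ∀ v, LabelIso L L' v.1 (e v).1) :
    LabelIso L L' u u' := by
  choose h hh using h
  obtain ⟨H, hH⟩ := exists_subtreeIso_glue e h
  refine ⟨H, fun x => ?_⟩
  by_cases hx : (x : T) = u
  · have : x = ⟨u, le_rfl⟩ := Subtype.ext hx
    rw [this, subtreeIso_root, ← hL]
  · obtain ⟨v, hv, hvx⟩ := exists_child_le (lt_of_le_of_ne x.2 (Ne.symm hx))
    have h1 := hH ⟨v, hv⟩ ⟨x, hvx⟩
    have h2 := hh ⟨v, hv⟩ ⟨x, hvx⟩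
    rw [h2, ← h1]

theorem LabelIso.of_isLeaf [Finite T] [Finite T'] (hL : L u = L' u') (hu : IsLeaf u)
    (hu' : IsLeaf u') : LabelIso L L' u u' := by
  have : Unique (Set.Ici u) := ⟨⟨⟨u, le_rfl⟩⟩, leaf_subsingleton hu⟩
  have : Unique (Set.Ici u') := ⟨⟨⟨u', le_rfl⟩⟩, leaf_subsingleton hu'⟩
  refine ⟨OrderIso.ofUnique _ _, fun x => ?_⟩
  rw [leaf_subsingleton hu x, leaf_subsingleton hu' (OrderIso.ofUnique _ _ _)]
  exact hL

open scoped Classical in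
/-- Children of `u` and `u'` with the same labels are equally many. -/
theorem LabelIso.card_children [Finite T] [Finite T'] (h : LabelIso L L' u u') (x : X) : ((children u).filter (L · = x)).card = ((children u').filter (L' · = x)).card := by
  obtain ⟨h, hh⟩ := h
  refine Finset.card_bij' (fun v hv => (h ⟨v, (mem_children.1 (Finset.mem_filter.1 hv).1).le⟩ : T'))
    (fun v hv => (h.symm ⟨v, (mem_children.1 (Finset.mem_filter.1 hv).1).le⟩ : T)) ?_ ?_ ?_ ?_
  · intro v hv
    rw [Finset.mem_filter, mem_children] at hv ⊢
    exact ⟨subtreeIso_child h hv.1, by rw [← hh]; exact hv.2⟩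
  · intro v hv
    rw [Finset.mem_filter, mem_children] at hv ⊢
    exact ⟨subtreeIso_child h.symm hv.1, by rw [hh]; simpa using hv.2⟩
  · intro v hv
    exact congrArg Subtype.val (h.symm_apply_apply _)
  · intro v hv
    exact congrArg Subtype.val (h.apply_symm_apply _)

end LabelIso

/-! ### A numerical identity for conjugate partitions. -/

section Young

/-- Both sides count triples of a row and two columns, possibly equal, that both meet it: columns
`j` and `k` share exactly `min (colLen j) (colLen k)` rows, because the columns of a diagram are
nested. -/
theorem sum_sq_rowLens (μ : YoungDiagram) :
    ((μ.rowLens : Multiset ℕ).map fun n => n ^ 2).sum =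
      ((μ.transpose.rowLens : Multiset ℕ).map fun a =>
        ((μ.transpose.rowLens : Multiset ℕ).map fun b => min a b).sum).sum := by
  have key : ∑ i ∈ Finset.range (μ.colLen 0), μ.rowLen i ^ 2 =
      ∑ j ∈ Finset.range (μ.rowLen 0), ∑ k ∈ Finset.range (μ.rowLen 0),
        min (μ.colLen j) (μ.colLen k) := by
    have h1 : ∀ i, μ.rowLen i ^ 2 = ∑ j ∈ Finset.range (μ.rowLen 0),
        ∑ k ∈ Finset.range (μ.rowLen 0), if i < min (μ.colLen j) (μ.colLen k) then 1 else 0 := by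
      intro i
      have h2 : μ.rowLen i = ∑ j ∈ Finset.range (μ.rowLen 0), if i < μ.colLen j then 1 else 0 := by
        rw [Finset.sum_boole]
        have : (Finset.range (μ.rowLen 0)).filter (fun j => i < μ.colLen j) =
            Finset.range (μ.rowLen i) := by
          ext j
          rw [Finset.mem_filter, Finset.mem_range, Finset.mem_range,
            ← YoungDiagram.mem_iff_lt_colLen, ← YoungDiagram.mem_iff_lt_rowLen,
            ← YoungDiagram.mem_iff_lt_rowLen, and_iff_right_iff_imp]
          exact fun h => μ.up_left_mem (Nat.zero_le _) le_rfl h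
        rw [this]
        simp
      rw [sq]
      conv_lhs => rw [h2]
      rw [Finset.sum_mul_sum]
      refine Finset.sum_congr rfl fun j _ => Finset.sum_congr rfl fun k _ => ?_
      simp only [lt_min_iff]
      by_cases hj : i < μ.colLen j <;> by_cases hk : i < μ.colLen k <;> simp [hj, hk]
    rw [Finset.sum_congr rfl fun i _ => h1 i, Finset.sum_comm]
    refine Finset.sum_congr rfl fun j _ => ?_
    rw [Finset.sum_comm]
    refine Finset.sum_congr rfl fun k _ => ?_
    rw [Finset.sum_boole]
    have : (Finset.range (μ.colLen 0)).filter (fun i => i < min (μ.colLen j) (μ.colLen k)) =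
        Finset.range (min (μ.colLen j) (μ.colLen k)) := by
      ext i
      rw [Finset.mem_filter, Finset.mem_range, Finset.mem_range, and_iff_right_iff_imp]
      intro h
      exact lt_of_lt_of_le (lt_of_lt_of_le h (min_le_left _ _)) (μ.colLen_anti 0 j (Nat.zero_le _))
    rw [this]
    simp
  have hR : ∀ (ν : YoungDiagram) (f : ℕ → ℕ), ((ν.rowLens : Multiset ℕ).map f).sum =
      ∑ i ∈ Finset.range (ν.colLen 0), f (ν.rowLen i) := by
    intro ν f
    rw [Finset.sum_eq_multiset_sum, YoungDiagram.rowLens, ← Multiset.map_coe, Multiset.map_map]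
    rfl
  rw [hR, hR, key]
  simp only [hR, YoungDiagram.rowLen_transpose, YoungDiagram.colLen_transpose]

end Young

/-! ### Bijections from equal fibre cardinalities. -/

section Bijections

theorem exists_equiv_of_card_fiber {A B K : Type*} [Finite A] [Finite B] (f : A → K) (g : B → K)
    (h : ∀ k, Nat.card {a // f a = k} = Nat.card {b // g b = k}) :
    ∃ e : A ≃ B, ∀ a, g (e a) = f a :=
  ⟨Equiv.ofFiberEquiv fun k => (Finite.card_eq.1 (h k)).some, fun a => Equiv.ofFiberEquiv_map _ a⟩

theorem natCard_subtype_subtype {A : Type*} {p : A → Prop} (q : A → Prop) (s : Finset A)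
    (hs : ∀ a, a ∈ s ↔ p a ∧ q a) : Nat.card {a : {a // p a} // q a.1} = s.card := by
  rw [← Nat.subtype_card s hs]
  exact Nat.card_congr (Equiv.subtypeSubtypeEquivSubtypeInter p q)

end Bijections

/-! ### Nested 0-1 tables and their uniqueness. -/

section Tables

open Finset

open scoped Classical in
/-- The elements of `s`, put into the cells of a table with rows indexed by `X` and columns indexed
by `Y`, occupy every cell at most once, and a row only meets columns of one type. -/
structure ZeroOneTable {V X Y Z : Type*} (s : Finset V) (a : V → X) (b : V → Y) (t : Y → Z) :
    Prop where
  eq_of_eq : ∀ v ∈ s, ∀ v' ∈ s, a v = a v' → b v = b v' → v = v'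
  type_eq : ∀ v ∈ s, ∀ v' ∈ s, a v = a v' → t (b v) = t (b v')

open scoped Classical in
/-- A table is nested if the columns of the same type form a chain. -/
def NestedTable {V X Y Z : Type*} (s : Finset V) (a : V → X) (b : V → Y) (t : Y → Z) : Prop :=
  ∀ v ∈ s, ∀ y, t (b v) = t y → #{w ∈ s | b w = b v} ≤ #{w ∈ s | b w = y} →
    ∃ w ∈ s, b w = y ∧ a w = a v

variable {V V' X X' Y Z : Type*} {s : Finset V} {a : V → X} {b : V → Y} {t : Y → Z}
  {s' : Finset V'} {a' : V' → X'} {b' : V' → Y}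

-- A pair of elements in one row is sent to its pair of columns. In the fibre over two columns each
-- coordinate determines the other, since a cell holds at most one element; so the fibre injects
-- into both columns. In case of equality it fills the shorter one, which is nestedness.
open scoped Classical in
theorem ZeroOneTable.card_pairs_le (h : ZeroOneTable s a b t) {D : Finset Y}
    (hD : ∀ v ∈ s, b v ∈ D) :
    #{p ∈ s ×ˢ s | a p.1 = a p.2} ≤
      ∑ q ∈ D ×ˢ D with t q.1 = t q.2, min #{w ∈ s | b w = q.1} #{w ∈ s | b w = q.2} ∧
    (#{p ∈ s ×ˢ s | a p.1 = a p.2} =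
      ∑ q ∈ D ×ˢ D with t q.1 = t q.2, min #{w ∈ s | b w = q.1} #{w ∈ s | b w = q.2} →
      NestedTable s a b t) := by
  have hfib := Finset.card_eq_sum_card_fiberwise (s := {p ∈ s ×ˢ s | a p.1 = a p.2})
    (t := {q ∈ D ×ˢ D | t q.1 = t q.2}) (f := fun p => (b p.1, b p.2)) (by
      intro p hp
      simp only [coe_filter, mem_product, Set.mem_ofPred_eq] at hp ⊢
      exact ⟨⟨hD _ hp.1.1, hD _ hp.1.2⟩, h.type_eq _ hp.1.1 _ hp.1.2 hp.2⟩)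
  have inj1 : ∀ q : Y × Y, Set.InjOn Prod.fst
      (({p ∈ {p ∈ s ×ˢ s | a p.1 = a p.2} | (b p.1, b p.2) = q} : Finset (V × V)) :
        Set (V × V)) := by
    rintro q ⟨p1, p2⟩ hp ⟨p1', p2'⟩ hp' hpp
    simp only [coe_filter, mem_filter, mem_product, Set.mem_ofPred_eq] at hp hp' hpp
    subst hpp
    refine Prod.ext rfl (h.eq_of_eq _ hp.1.1.2 _ hp'.1.1.2 (hp.1.2.symm.trans hp'.1.2) ?_)
    exact congrArg Prod.snd (hp.2.trans hp'.2.symm)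
  have inj2 : ∀ q : Y × Y, Set.InjOn Prod.snd
      (({p ∈ {p ∈ s ×ˢ s | a p.1 = a p.2} | (b p.1, b p.2) = q} : Finset (V × V)) :
        Set (V × V)) := by
    rintro q ⟨p1, p2⟩ hp ⟨p1', p2'⟩ hp' hpp
    simp only [coe_filter, mem_filter, mem_product, Set.mem_ofPred_eq] at hp hp' hpp
    subst hpp
    refine Prod.ext (h.eq_of_eq _ hp.1.1.1 _ hp'.1.1.1 (hp.1.2.trans hp'.1.2.symm) ?_) rfl
    exact congrArg Prod.fst (hp.2.trans hp'.2.symm)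
  have hle : ∀ q ∈ ({q ∈ D ×ˢ D | t q.1 = t q.2} : Finset (Y × Y)),
      #{p ∈ {p ∈ s ×ˢ s | a p.1 = a p.2} | (b p.1, b p.2) = q} ≤
        min #{w ∈ s | b w = q.1} #{w ∈ s | b w = q.2} := by
    intro q _
    refine le_min (card_le_card_of_injOn Prod.fst ?_ (inj1 q))
      (card_le_card_of_injOn Prod.snd ?_ (inj2 q))
    · intro p hp
      simp only [coe_filter, mem_filter, mem_product, Set.mem_ofPred_eq] at hp ⊢
      exact ⟨hp.1.1.1, congrArg Prod.fst hp.2⟩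
    · intro p hp
      simp only [coe_filter, mem_filter, mem_product, Set.mem_ofPred_eq] at hp ⊢
      exact ⟨hp.1.1.2, congrArg Prod.snd hp.2⟩
  refine ⟨hfib.le.trans (sum_le_sum hle), fun heq v hv y hty hcard => ?_⟩
  have hterm := (sum_eq_sum_iff_of_le hle).1 (hfib.symm.trans heq)
  have hyD : y ∈ D := by
    have h1 : 0 < #{w ∈ s | b w = y} :=
      lt_of_lt_of_le (card_pos.2 ⟨v, mem_filter.2 ⟨hv, (rfl : b v = b v)⟩⟩) hcard
    obtain ⟨w, hw⟩ := card_pos.1 h1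
    rw [mem_filter] at hw
    exact hw.2 ▸ hD w hw.1
  have hq := hterm (b v, y) (mem_filter.2 ⟨mem_product.2 ⟨hD v hv, hyD⟩, hty⟩)
  rw [min_eq_left hcard] at hq
  -- The injection into the shorter column is onto, so `v` has a partner in column `y` on its own
  -- row.
  have himg : ({p ∈ {p ∈ s ×ˢ s | a p.1 = a p.2} | (b p.1, b p.2) = (b v, y)}).image Prod.fst =
      {w ∈ s | b w = b v} := by
    refine eq_of_subset_of_card_le ?_ ?_
    · intro w hw
      obtain ⟨p, hp, rfl⟩ := mem_image.1 hw
      simp only [mem_filter, mem_product] at hp ⊢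
      exact ⟨hp.1.1.1, congrArg Prod.fst hp.2⟩
    · rw [card_image_of_injOn (inj1 _), hq]
  have hvm : v ∈ ({w ∈ s | b w = b v} : Finset V) := mem_filter.2 ⟨hv, rfl⟩
  rw [← himg] at hvm
  obtain ⟨p, hp, rfl⟩ := mem_image.1 hvm
  simp only [mem_filter, mem_product] at hp
  exact ⟨p.2, hp.1.1.2, congrArg Prod.snd hp.2, hp.1.2.symm⟩

open scoped Classical in
theorem ZeroOneTable.card_row (h : ZeroOneTable s a b t) (x : X) :
    #({v ∈ s | a v = x}.image b) = #{v ∈ s | a v = x} := by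
  refine card_image_of_injOn ?_
  intro v hv v' hv' hvv
  simp only [coe_filter, Set.mem_ofPred_eq] at hv hv'
  exact h.eq_of_eq _ hv.1 _ hv'.1 (hv.2.trans hv'.2.symm) hvv

open scoped Classical in
/-- In nested tables with the same column sums, a shorter row has its support inside that of a
longer row. -/
theorem row_subset_row (h : ZeroOneTable s a b t) (hn : NestedTable s a b t)
    (h' : ZeroOneTable s' a' b' t) (hn' : NestedTable s' a' b' t)
    (hcol : ∀ y, #{v ∈ s | b v = y} = #{v ∈ s' | b' v = y}) {x : X} {x' : X'}
    (hty : ∀ v ∈ s, ∀ v' ∈ s', a v = x → a' v' = x' → t (b v) = t (b' v'))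
    (hle : #{v ∈ s | a v = x} ≤ #{v ∈ s' | a' v = x'}) :
    {v ∈ s | a v = x}.image b ⊆ {v ∈ s' | a' v = x'}.image b' := by
  rw [← h.card_row, ← h'.card_row] at hle
  intro y hy
  by_contra hy'
  -- If the short row had a column outside the long one, the long row would have one outside the
  -- short. Nestedness, applied to the smaller of the two columns, puts the larger one in the same
  -- row, a contradiction.
  obtain ⟨z, hz', hz⟩ : ∃ z ∈ {v ∈ s' | a' v = x'}.image b', z ∉ {v ∈ s | a v = x}.image b := by
    by_contra! hcon
    exact (card_lt_card ⟨hcon, fun hsub => hy' (hsub hy)⟩).not_ge hle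
  obtain ⟨v, hv, rfl⟩ := mem_image.1 hy
  obtain ⟨v', hv', rfl⟩ := mem_image.1 hz'
  rw [mem_filter] at hv hv'
  have htt := hty v hv.1 v' hv'.1 hv.2 hv'.2
  rcases le_total #{w ∈ s | b w = b v} #{w ∈ s | b w = b' v'} with hc | hc
  · obtain ⟨w, hw, hwb, hwa⟩ := hn v hv.1 _ htt hc
    exact hz (mem_image.2 ⟨w, mem_filter.2 ⟨hw, hwa.trans hv.2⟩, hwb⟩)
  · rw [hcol, hcol] at hc
    obtain ⟨w, hw, hwb, hwa⟩ := hn' v' hv'.1 _ htt.symm hc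
    exact hy' (mem_image.2 ⟨w, mem_filter.2 ⟨hw, hwa.trans hv'.2⟩, hwb⟩)

-- Take the shortest row `x₀` counted on the left and its smallest column `y₀`. Every row counted on
-- the left contains the support of `x₀`, so it meets `y₀`. In the other table, every row meeting
-- `y₀` meets all the columns of `x₀` by nestedness, so it is counted on the right. The height of
-- `y₀`, common to both tables, separates the two counts.
open scoped Classical in
theorem card_long_rows_le (h : ZeroOneTable s a b t) (hn : NestedTable s a b t)
    (h' : ZeroOneTable s' a' b' t) (hn' : NestedTable s' a' b' t)
    (hcol : ∀ y, #{v ∈ s | b v = y} = #{v ∈ s' | b' v = y}) {f : X → Z} {f' : X' → Z}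
    (hf : ∀ v ∈ s, f (a v) = t (b v)) (hf' : ∀ v ∈ s', f' (a' v) = t (b' v)) (z : Z) (k : ℕ) :
    #{x ∈ s.image a | f x = z ∧ k ≤ #{v ∈ s | a v = x}} ≤
      #{x ∈ s'.image a' | f' x = z ∧ k ≤ #{v ∈ s' | a' v = x}} := by
  rcases ({x ∈ s.image a | f x = z ∧ k ≤ #{v ∈ s | a v = x}}).eq_empty_or_nonempty with he | hne
  · rw [he]; simp
  obtain ⟨x₀, hx₀, hmin⟩ := exists_min_image _ (fun x => #{v ∈ s | a v = x}) hne
  rw [mem_filter, mem_image] at hx₀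
  obtain ⟨⟨v₀, hv₀, hv₀x⟩, hx₀z, hk⟩ := hx₀
  obtain ⟨y₀, hy₀, hymin⟩ := exists_min_image ({v ∈ s | a v = x₀}.image b)
    (fun y => #{v ∈ s | b v = y}) ⟨b v₀, mem_image_of_mem _ (mem_filter.2 ⟨hv₀, hv₀x⟩)⟩
  obtain ⟨v₁, hv₁, hv₁y⟩ := mem_image.1 hy₀
  rw [mem_filter] at hv₁
  have h1 : ({x ∈ s.image a | f x = z ∧ k ≤ #{v ∈ s | a v = x}}) ⊆ {v ∈ s | b v = y₀}.image a := by
    intro x hx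
    have hsub := row_subset_row h hn h hn (fun _ => rfl) (x := x₀) (x' := x) (by
      intro v hv v' hv' hvx hvx'
      rw [← hf v hv, ← hf v' hv', hvx, hvx', hx₀z, (mem_filter.1 hx).2.1]) (hmin x hx)
    obtain ⟨w, hw, hwy⟩ := mem_image.1 (hsub hy₀)
    rw [mem_filter] at hw
    exact mem_image.2 ⟨w, mem_filter.2 ⟨hw.1, hwy⟩, hw.2⟩
  have h2 : {v ∈ s' | b' v = y₀}.image a' ⊆
      {x ∈ s'.image a' | f' x = z ∧ k ≤ #{v ∈ s' | a' v = x}} := by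
    intro x hx
    obtain ⟨w, hw, rfl⟩ := mem_image.1 hx
    rw [mem_filter] at hw
    have hz : t y₀ = z := by rw [← hv₁y, ← hf _ hv₁.1, hv₁.2, hx₀z]
    refine mem_filter.2 ⟨mem_image_of_mem _ hw.1, by rw [hf' _ hw.1, hw.2, hz], hk.trans ?_⟩
    rw [← h.card_row, ← h'.card_row]
    refine card_le_card fun y hy => ?_
    obtain ⟨v, hv, hvy⟩ := mem_image.1 hy
    rw [mem_filter] at hv
    have hc := hymin y hy
    simp only [hcol] at hc
    have hty : t (b' w) = t y := by
      rw [hw.2, hz, ← hvy, ← hf v hv.1, hv.2, hx₀z]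
    obtain ⟨w', hw', hb, ha⟩ := hn' w hw.1 y hty (by rw [hw.2]; exact hc)
    exact mem_image.2 ⟨w', mem_filter.2 ⟨hw', ha⟩, hb⟩
  calc _ ≤ #({v ∈ s | b v = y₀}.image a) := card_le_card h1
    _ ≤ #{v ∈ s | b v = y₀} := card_image_le
    _ = #{v ∈ s' | b' v = y₀} := hcol y₀
    _ = #({v ∈ s' | b' v = y₀}.image a') := by
      refine (card_image_of_injOn ?_).symm
      intro v hv v' hv' hvv
      simp only [coe_filter, Set.mem_ofPred_eq] at hv hv'
      exact h'.eq_of_eq _ hv.1 _ hv'.1 hvv (hv.2.trans hv'.2.symm)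
    _ ≤ _ := card_le_card h2

open scoped Classical in
theorem card_filter_and_le {W : Type*} (S : Finset W) (p : W → Prop) (r : W → ℕ) (k : ℕ) :
    #{x ∈ S | p x ∧ k ≤ r x} = #{x ∈ S | p x ∧ r x = k} + #{x ∈ S | p x ∧ k + 1 ≤ r x} := by
  rw [← card_union_of_disjoint]
  · congr 1
    ext x
    simp only [mem_filter, mem_union, ← and_or_left]
    refine and_congr_right fun _ => and_congr_right fun _ => ?_
    omega
  · rw [disjoint_left]
    intro x hx hx'
    rw [mem_filter] at hx hx'
    omega

open scoped Classical in
/-- In nested tables with the same column sums, the rows of each type and length are equally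
many. -/
theorem card_rows_eq (h : ZeroOneTable s a b t) (hn : NestedTable s a b t)
    (h' : ZeroOneTable s' a' b' t) (hn' : NestedTable s' a' b' t)
    (hcol : ∀ y, #{v ∈ s | b v = y} = #{v ∈ s' | b' v = y}) {f : X → Z} {f' : X' → Z}
    (hf : ∀ v ∈ s, f (a v) = t (b v)) (hf' : ∀ v ∈ s', f' (a' v) = t (b' v)) (z : Z) (k : ℕ) :
    #{x ∈ s.image a | f x = z ∧ #{v ∈ s | a v = x} = k} =
      #{x ∈ s'.image a' | f' x = z ∧ #{v ∈ s' | a' v = x} = k} := by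
  have heq : ∀ k, #{x ∈ s.image a | f x = z ∧ k ≤ #{v ∈ s | a v = x}} =
      #{x ∈ s'.image a' | f' x = z ∧ k ≤ #{v ∈ s' | a' v = x}} := fun k =>
    le_antisymm (card_long_rows_le h hn h' hn' hcol hf hf' z k)
      (card_long_rows_le h' hn' h hn (fun y => (hcol y).symm) hf' hf z k)
  have e1 := heq k
  have e2 := heq (k + 1)
  rw [card_filter_and_le (s.image a), card_filter_and_le (s'.image a')] at e1
  omega

end Tables

/-! ### Equivalence of restrictions. -/

section Equivalence

variable {T₁ T₂ T₃ P₁ P₂ P₃ : Type*} [PartialOrder T₁] [PartialOrder T₂] [PartialOrder T₃]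
  [PartialOrder P₁] [PartialOrder P₂] [PartialOrder P₃]
  {φ₁ : T₁ →o P₁} {φ₂ : T₂ →o P₂} {φ₃ : T₃ →o P₃}

theorem Equivalent.symm (h : Equivalent φ₁ φ₂) : Equivalent φ₂ φ₁ := by
  obtain ⟨τ, ω, h⟩ := h
  exact ⟨τ.symm, ω.symm, fun w => by rw [ω.symm_apply_eq, h]; simp⟩

theorem Equivalent.trans (h : Equivalent φ₁ φ₂) (h' : Equivalent φ₂ φ₃) : Equivalent φ₁ φ₃ := by
  obtain ⟨τ, ω, h⟩ := h
  obtain ⟨τ', ω', h'⟩ := h'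
  exact ⟨τ.trans τ', ω.trans ω', fun w => by simp [h, h']⟩

variable {T P : Type*} [PartialOrder T] [PartialOrder P] {φ : T →o P}

theorem LabelIso.equivalent {u w : T} (h : LabelIso φ φ u w) :
    Equivalent (restrict φ u) (restrict φ w) := by
  have huw := h.label_eq
  obtain ⟨τ, hτ⟩ := h
  refine ⟨τ, OrderIso.setCongr _ _ (by rw [huw]), fun x => Subtype.ext ?_⟩
  exact hτ x

theorem subtree_equivalent_isLeaf [Finite T] {u w : T}
    (h : Equivalent (restrict φ u) (restrict φ w)) (hu : IsLeaf u) : IsLeaf w := by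
  obtain ⟨τ, -, -⟩ := h
  exact subtreeIso_isLeaf τ hu

end Equivalence

/-! ### Structure of compositions and gluing of equivalences. -/

section Compositions

variable {T P : Type*} [PartialOrder T] [OrderBot T] [PartialOrder P] [OrderBot P] {φ : T →o P}

theorem IsComposition.internal (h : IsComposition φ) {u : T} (hu : Internal u) :
    Internal (φ u) := by
  obtain ⟨w, hw⟩ := hu
  exact ⟨φ w, h.map_child _ _ hw⟩

theorem IsComposition.isLeaf_iff (h : IsComposition φ) {u : T} : IsLeaf (φ u) ↔ IsLeaf u :=
  ⟨fun hu _ hw => hu _ (h.map_child _ _ hw), h.map_leaf u⟩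

theorem IsComposition.isLeaf_congr (h : IsComposition φ) {u w : T} (he : φ u = φ w)
    (hu : IsLeaf u) : IsLeaf w := by
  rw [← h.isLeaf_iff, ← he, h.isLeaf_iff]
  exact hu

theorem IsComposition.ne_bot [Finite T] (h : IsComposition φ) {u : T} (hu : u ≠ ⊥) :
    φ u ≠ ⊥ := by
  obtain ⟨p, hp⟩ := exists_parent hu
  exact (lt_of_le_of_lt bot_le (h.map_child _ _ hp).lt).ne'

/-- Vertices with the same image under a composition have isomorphic labelled subtrees. -/
theorem IsComposition.labelIso_of_eq [Finite T] [PredOrder P] (h : IsComposition φ) {u w : T}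
    (huw : φ u = φ w) : LabelIso φ φ u w := by
  induction u using WellFoundedLT.induction generalizing w with
  | ind u ih =>
    by_cases hu : u = ⊥
    · subst hu
      rw [h.map_bot] at huw
      have hw : w = ⊥ := by
        by_contra hw
        exact h.ne_bot hw huw.symm
      subst hw
      exact LabelIso.refl _ _
    · have hw : w ≠ ⊥ := by
        rintro rfl
        rw [h.map_bot] at huw
        exact h.ne_bot hu huw
      -- Regularity only compares siblings. The isomorphism between the subtrees of the parents,
      -- known by induction, carries `u` to a sibling `v` of `w` with the same image, and regularity
      -- applies to `v` and `w`.
      obtain ⟨p, hp⟩ := exists_parent hu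
      obtain ⟨q, hq⟩ := exists_parent hw
      have hpq : φ p = φ q :=
        parent_unique (huw ▸ h.map_child _ _ hp) (h.map_child _ _ hq)
      obtain ⟨v, hv, huv⟩ := (ih p hp.lt hpq).exists_child hp
      refine huv.trans ?_
      have hvw : φ v = φ w := huv.label_eq.symm.trans huw
      rcases isLeaf_or_internal v with hvl | hvi
      · exact LabelIso.of_isLeaf hvw hvl (h.isLeaf_congr hvw hvl)
      · rcases isLeaf_or_internal w with hwl | hwi
        · exact absurd (h.isLeaf_congr hvw.symm hwl) hvi.not_isLeaf
        · exact h.regular v w ⟨q, hv, hq⟩ hvi hwi hvw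

theorem IsComposition.exists_child [Finite T] [PredOrder P] (h : IsComposition φ) {u : T} {x : P}
    (hx : φ u ⋖ x) : ∃ v, u ⋖ v ∧ φ v = x := by
  obtain ⟨v, rfl⟩ := h.surjective x
  have hv : v ≠ ⊥ := by
    rintro rfl
    rw [h.map_bot] at hx
    exact not_lt_bot hx.lt
  obtain ⟨p, hp⟩ := exists_parent hv
  have hup : φ p = φ u := parent_unique (h.map_child _ _ hp) hx
  obtain ⟨w, hw, hvw⟩ := (h.labelIso_of_eq hup).exists_child hp
  exact ⟨w, hw, hvw.label_eq.symm⟩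

theorem IsComposition.image_children [Finite T] [Finite P] [PredOrder P] [DecidableEq P]
    (h : IsComposition φ) (u : T) : (children u).image φ = children (φ u) := by
  ext x
  rw [Finset.mem_image, mem_children]
  constructor
  · rintro ⟨v, hv, rfl⟩
    exact h.map_child _ _ (mem_children.1 hv)
  · intro hx
    obtain ⟨v, hv, rfl⟩ := h.exists_child hx
    exact ⟨v, mem_children.2 hv, rfl⟩

/-- One isomorphism `ω` of targets serves all vertices over `x` and `x'` at once, as these have
isomorphic labelled subtrees. Gluing needs this uniformity, since several children may share an
image. -/
theorem IsComposition.exists_lift [Finite T] [PredOrder P] (h : IsComposition φ) {v₀ w₀ : T}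
    {x x' : P} (hx : φ v₀ = x) (hx' : φ w₀ = x')
    (heq : Equivalent (restrict φ v₀) (restrict φ w₀)) :
    ∃ ω : Set.Ici x ≃o Set.Ici x', ∀ v w : T, φ v = x → φ w = x' →
      ∃ τ : Set.Ici v ≃o Set.Ici w, ∀ (y : Set.Ici v) (hy : φ y ∈ Set.Ici x),
        (ω ⟨φ y, hy⟩ : P) = φ (τ y) := by
  subst hx hx'
  obtain ⟨τ, ω, hτ⟩ := heq
  refine ⟨ω, fun v w hv hw => ?_⟩
  obtain ⟨h₁, hh₁⟩ := h.labelIso_of_eq hv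
  obtain ⟨h₂, hh₂⟩ := h.labelIso_of_eq hw.symm
  refine ⟨(h₁.trans τ).trans h₂, fun y hy => ?_⟩
  have h3 := congrArg Subtype.val (hτ (h₁ y))
  change _ = φ (h₂ (τ (h₁ y)))
  rw [← hh₂]
  refine Eq.trans ?_ h3
  congr 2
  exact Subtype.ext (hh₁ y)

/-- An equivalence of restrictions is glued from compatible equivalences at the children. -/
theorem IsComposition.equivalent_glue [PredOrder T] [IsPredArchimedean T] [Finite T]
    [PredOrder P] [IsPredArchimedean P] [Finite P] (h : IsComposition φ) {u w : T}
    (e₀ : {x // φ u ⋖ x} ≃ {x // φ w ⋖ x}) (e : {v // u ⋖ v} ≃ {v // w ⋖ v})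
    (he : ∀ v, φ (e v).1 = (e₀ ⟨φ v.1, h.map_child _ _ v.2⟩).1)
    (heq : ∀ v v', u ⋖ v → w ⋖ v' → (∃ x, φ v = x.1 ∧ φ v' = (e₀ x).1) →
      Equivalent (restrict φ v) (restrict φ v')) :
    Equivalent (restrict φ u) (restrict φ w) := by
  classical
  have hω : ∀ x : {x // φ u ⋖ x}, ∃ ω : Set.Ici x.1 ≃o Set.Ici (e₀ x).1, ∀ v w : T, φ v = x.1 →
      φ w = (e₀ x).1 → ∃ τ : Set.Ici v ≃o Set.Ici w, ∀ (y : Set.Ici v) (hy : φ y ∈ Set.Ici x.1),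
        (ω ⟨φ y, hy⟩ : P) = φ (τ y) := by
    intro x
    obtain ⟨v, hv, hvx⟩ := h.exists_child x.2
    obtain ⟨v', hv', hvx'⟩ := h.exists_child (e₀ x).2
    exact h.exists_lift hvx hvx' (heq v v' hv hv' ⟨x, hvx, hvx'⟩)
  choose ω hω using hω
  obtain ⟨Ω, hΩ⟩ := exists_subtreeIso_glue e₀ ω
  -- Relabelling by `Ω ∘ φ` turns the equivalence into a labelled isomorphism; the value `⊥` never
  -- occurs on the subtree at `u`.
  let L : T → P := fun x => if hx : φ u ≤ φ x then (Ω ⟨φ x, hx⟩).1 else ⊥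
  have hL : ∀ (x : T) (hx : φ u ≤ φ x), L x = (Ω ⟨φ x, hx⟩).1 := fun x hx => dif_pos hx
  have key : LabelIso L φ u w := by
    refine LabelIso.glue ?_ e fun v => ?_
    · rw [hL u le_rfl, subtreeIso_root]
    · obtain ⟨τ, hτ⟩ := hω ⟨φ v.1, h.map_child _ _ v.2⟩ v.1 (e v).1 rfl (he v)
      refine ⟨τ, fun y => ?_⟩
      rw [hL y (φ.monotone (le_trans v.2.le y.2)), ← hτ y (φ.monotone y.2)]
      exact hΩ ⟨φ v.1, h.map_child _ _ v.2⟩ ⟨φ y, φ.monotone y.2⟩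
  obtain ⟨τ, hτ⟩ := key
  exact ⟨τ, Ω, fun x => Subtype.ext ((hL x (φ.monotone x.2)).symm.trans (hτ x))⟩

end Compositions

/-! ### Among siblings, a quotient detects equivalence of restrictions. -/

section Quotients

variable {T P Q : Type*} [PartialOrder T] [OrderBot T] [PartialOrder P] [OrderBot P]
  [PartialOrder Q] [OrderBot Q] {φ : T →o P} {α : P →o Q}

/-- Condition (b) settles internal siblings; for leaves, condition (a) leaves only one possible
image. -/
theorem IsQuotient.eq_of_equivalent [Finite T] (hφ : IsComposition φ) (hα : IsQuotient φ α)
    {p v w : T} (hv : p ⋖ v) (hw : p ⋖ w) (h : Equivalent (restrict φ v) (restrict φ w)) :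
    α (φ v) = α (φ w) := by
  have hv' := hφ.map_child _ _ hv
  have hw' := hφ.map_child _ _ hw
  rcases isLeaf_or_internal v with hvl | hvi
  · have hwl := subtree_equivalent_isLeaf h hvl
    exact (hα.leaves _ _ hw' (hφ.map_leaf _ hwl)).2 _ (hα.isComposition.map_child _ _ hv')
      (hα.leaves _ _ hv' (hφ.map_leaf _ hvl)).1
  · rcases isLeaf_or_internal w with hwl | hwi
    · exact absurd (subtree_equivalent_isLeaf h.symm hwl) hvi.not_isLeaf
    · by_contra hne
      exact hα.not_equivalent v w ⟨p, hv, hw⟩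
        ⟨α (φ p), hα.isComposition.map_child _ _ hv', hα.isComposition.map_child _ _ hw'⟩ hne
        (hα.isComposition.internal (hφ.internal hvi)) (hα.isComposition.internal (hφ.internal hwi)) h

theorem IsQuotient.equivalent_of_eq [Finite T] [Finite P] (hφ : IsComposition φ)
    (hα : IsQuotient φ α) {u w : T} (h : α (φ u) = α (φ w)) :
    Equivalent (restrict φ u) (restrict φ w) := by
  have hleaf : ∀ {x : T}, IsLeaf (α (φ x)) ↔ IsLeaf x := fun {x} => by
    rw [hα.isComposition.isLeaf_iff, hφ.isLeaf_iff]
  rcases isLeaf_or_internal u with hu | hu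
  · have hw : IsLeaf w := by rwa [← hleaf, ← h, hleaf]
    have hu' := hφ.map_leaf _ hu
    have hw' := hφ.map_leaf _ hw
    obtain ⟨τ, -⟩ := LabelIso.of_isLeaf (L := fun _ => ()) (L' := fun _ => ()) rfl hu hw
    obtain ⟨ω, -⟩ := LabelIso.of_isLeaf (L := fun _ => ()) (L' := fun _ => ()) rfl hu' hw'
    exact ⟨τ, ω, fun x => (leaf_subsingleton hw' _).trans (leaf_subsingleton hw' _).symm⟩
  · have hw : Internal w := by
      rcases isLeaf_or_internal w with hw | hw
      · exact absurd (by rwa [← hleaf, h, hleaf]) hu.not_isLeaf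
      · exact hw
    exact (hα.equivalent u w hu hw h).1

end Quotients

open Finset

/-- Both sides have the same sum over the invariant set, so no termwise inequality can be strict. -/
theorem apply_eq_of_le_perm {T : Type*} [Finite T] (e : T ≃ T) {p : T → Prop}
    (hp : ∀ x, p (e x) ↔ p x) {g : T → ℕ} (h : ∀ x, p x → g x ≤ g (e x)) {x : T} (hx : p x) :
    g x = g (e x) := by
  classical
  have := Fintype.ofFinite T
  have hsum : ∑ y with p y, g y = ∑ y with p y, g (e y) := by
    refine (Finset.sum_equiv e (fun y => ?_) fun y _ => rfl).symm
    simp [hp]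
  exact (Finset.sum_eq_sum_iff_of_le fun y hy => h y (mem_filter.1 hy).2).1 hsum x
    (mem_filter.2 ⟨mem_univ _, hx⟩)

/-! ### Two rigid pairs differ by an automorphism. -/

section Uniqueness

variable {T P M Q : Type*} [PartialOrder T] [OrderBot T] [PartialOrder P] [OrderBot P]
  [PartialOrder M] [OrderBot M] [PartialOrder Q] [OrderBot Q]

/-- The pairs of siblings below `u` with the same image. -/
noncomputable def siblingPairs [Finite T] (φ : T →o P) (u : T) : Finset (T × T) := by
  classical exact {p ∈ children u ×ˢ children u | φ p.1 = φ p.2}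

open scoped Classical in
/-- At every vertex, the numbers of siblings with a given image under `φ` and under `ψ` satisfy the
identity `∑ rᵢ² = ∑ min(cⱼ, cₖ)` relating the row lengths and the column lengths of a collection of
Young diagrams indexed by the values of `β`. -/
def ConjugateFibers [Finite T] [Finite M] (φ : T →o P) (ψ : T →o M) (β : M → Q) : Prop :=
  ∀ w, #(siblingPairs φ w) =
    ∑ q ∈ children (ψ w) ×ˢ children (ψ w) with β q.1 = β q.2,
      min #{v ∈ children w | ψ v = q.1} #{v ∈ children w | ψ v = q.2}

/-- No two siblings have isomorphic subtrees, labelled by both `φ` and `ψ`. -/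
def RigidPair (φ : T →o P) (ψ : T → M) : Prop :=
  ∀ u v, Siblings u v → LabelIso (fun x => (φ x, ψ x)) (fun x => (φ x, ψ x)) u v → u = v

variable {φ : T →o P} {ψ : T →o M} {α : P →o Q} {β : M → Q} {σ σ' : T ≃o T}

/-- Two children in one cell have isomorphic labelled subtrees by `hB`, so rigidity identifies them.
Children `v`, `v'` in one row have equivalent restrictions, hence by `hA` so do their images under
`σ`; these are siblings, so `α` does not distinguish them. -/
theorem zeroOneTable_of_rigid [Finite T] (hφ : IsComposition φ) (hα : IsQuotient φ α)
    [Finite P] [PredOrder P]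
    (hβ : ∀ w, β (ψ w) = α (φ w)) (hσ : RigidPair φ (ψ ∘ σ)) {u : T}
    (hA : ∀ v, u ⋖ v → Equivalent (restrict φ v) (restrict φ (σ v)))
    (hB : ∀ v v', u ⋖ v → u ⋖ v' → φ v = φ v' → ψ (σ v) = ψ (σ v') →
      LabelIso (fun x => (φ x, (ψ ∘ σ) x)) (fun x => (φ x, (ψ ∘ σ) x)) v v') :
    ZeroOneTable (children u) φ (ψ ∘ σ) β := by
  constructor
  · intro v hv v' hv' h1 h2
    rw [mem_children] at hv hv'
    exact hσ v v' ⟨u, hv, hv'⟩ (hB v v' hv hv' h1 h2)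
  · intro v hv v' hv' h1
    rw [mem_children] at hv hv'
    change β (ψ (σ v)) = β (ψ (σ v'))
    rw [hβ, hβ]
    have hc : ∀ {x}, u ⋖ x → σ u ⋖ σ x := fun hx => (apply_covBy_apply_iff σ).2 hx
    exact hα.eq_of_equivalent hφ (hc hv) (hc hv')
      (((hA v hv).symm.trans (hφ.labelIso_of_eq h1).equivalent).trans (hA v' hv'))

open scoped Classical in
theorem card_column_comp [Finite T] (σ : T ≃o T) (u : T) (y : M) :
    #{v ∈ children u | (ψ ∘ σ) v = y} = #{v ∈ children (σ u) | ψ v = y} :=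
  LabelIso.card_children (L := ψ ∘ σ) (L' := ψ) ⟨subtreeIsoOfIso σ u, fun _ => rfl⟩ y

/-- The columns of the table at `u` are as long as those at `σ u`, where `hc` rewrites the bound on
pairs as a number of sibling pairs. -/
theorem card_siblingPairs_le [Finite T] [Finite M] (hψ : IsComposition ψ)
    (hc : ConjugateFibers φ ψ β) {u : T} (ht : ZeroOneTable (children u) φ (ψ ∘ σ) β) :
    #(siblingPairs φ u) ≤ #(siblingPairs φ (σ u)) ∧
      (#(siblingPairs φ u) = #(siblingPairs φ (σ u)) →
        NestedTable (children u) φ (ψ ∘ σ) β) := by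
  classical
  have h := ht.card_pairs_le (D := children (ψ (σ u))) (by
    intro v hv
    rw [mem_children] at hv ⊢
    exact hψ.map_child _ _ ((apply_covBy_apply_iff σ).2 hv))
  simp only [card_column_comp] at h
  rw [hc (σ u)]
  exact h

variable [PredOrder T] [IsPredArchimedean T] [Finite T] [PredOrder P] [IsPredArchimedean P]
  [Finite P] [PredOrder M] [Finite M]

/-- The tables at `u` and at `σ u` have the same column sums, so their rows can be matched with
equal type and length; the matched rows are then glued. -/
theorem equivalent_of_nested (hφ : IsComposition φ) (hα : IsQuotient φ α)
    (hβ : ∀ w, β (ψ w) = α (φ w)) {u : T}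
    (hA : ∀ v, u ⋖ v → Equivalent (restrict φ v) (restrict φ (σ v)))
    (ht : ZeroOneTable (children u) φ (ψ ∘ σ) β) (hn : NestedTable (children u) φ (ψ ∘ σ) β)
    (ht' : ZeroOneTable (children (σ u)) φ ψ β) (hn' : NestedTable (children (σ u)) φ ψ β) :
    Equivalent (restrict φ u) (restrict φ (σ u)) := by
  classical
  -- The type of a row at `u` is read off after applying `σ`, since `α` itself need not agree with
  -- it. The default `⊥` is not used: every child of `φ u` is the image of a child of `u`.
  let f : P → Q := fun x => if hx : ∃ v ∈ children u, φ v = x then β (ψ (σ hx.choose)) else ⊥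
  have hf : ∀ v ∈ children u, f (φ v) = β ((ψ ∘ σ) v) := by
    intro v hv
    have hx : ∃ w ∈ children u, φ w = φ v := ⟨v, hv, rfl⟩
    have h1 : f (φ v) = β (ψ (σ hx.choose)) := dif_pos hx
    rw [h1]
    exact ht.type_eq _ hx.choose_spec.1 _ hv hx.choose_spec.2
  have hcard := card_rows_eq ht hn ht' hn' (card_column_comp σ u) hf
    (fun v _ => (hβ v).symm)
  obtain ⟨e₀, he₀⟩ := exists_equiv_of_card_fiber
    (fun x : {x // φ u ⋖ x} => (f x, #{v ∈ children u | φ v = x.1}))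
    (fun x : {x // φ (σ u) ⋖ x} => (α x, #{v ∈ children (σ u) | φ v = x.1})) (by
      rintro ⟨z, k⟩
      have h1 := hcard z k
      rw [hφ.image_children, hφ.image_children] at h1
      rw [natCard_subtype_subtype (fun x => (f x, #{v ∈ children u | φ v = x}) = (z, k))
          {x ∈ children (φ u) | f x = z ∧ #{v ∈ children u | φ v = x} = k}
          (by intro a; simp),
        natCard_subtype_subtype (fun x => (α x, #{v ∈ children (σ u) | φ v = x}) = (z, k))
          {x ∈ children (φ (σ u)) | α x = z ∧ #{v ∈ children (σ u) | φ v = x} = k}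
          (by intro a; simp)]
      exact h1)
  obtain ⟨e, he⟩ := exists_equiv_of_card_fiber
    (fun v : {v // u ⋖ v} => e₀ ⟨φ v.1, hφ.map_child _ _ v.2⟩)
    (fun v : {v // σ u ⋖ v} => (⟨φ v.1, hφ.map_child _ _ v.2⟩ : {x // φ (σ u) ⋖ x})) (by
      intro k
      obtain ⟨x, rfl⟩ := e₀.surjective k
      have h1 := congrArg Prod.snd (he₀ x)
      simp only at h1
      have h2 : ∀ v : {v // u ⋖ v}, e₀ ⟨φ v.1, hφ.map_child _ _ v.2⟩ = e₀ x ↔ φ v.1 = x.1 := by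
        intro v
        rw [e₀.injective.eq_iff, Subtype.ext_iff]
      simp only [h2, Subtype.ext_iff]
      rw [natCard_subtype_subtype (fun v => φ v = x.1) {v ∈ children u | φ v = x.1}
          (by intro a; simp),
        natCard_subtype_subtype (fun v => φ v = (e₀ x).1) {v ∈ children (σ u) | φ v = (e₀ x).1}
          (by intro a; simp)]
      exact h1.symm)
  refine hφ.equivalent_glue e₀ e (fun v => congrArg Subtype.val (he v)) ?_
  rintro v v' hv hv' ⟨x, hx, hx'⟩
  -- Pass from `v` to `σ v` by `hA`; then `σ v` and `v'` have the same image under `α ∘ φ`, as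
  -- matched rows have equal types.
  refine (hA v hv).trans (hα.equivalent_of_eq hφ ?_)
  have h1 := congrArg Prod.fst (he₀ x)
  simp only at h1
  rw [← hβ, hx', h1, ← hx]
  exact (hf v (mem_children.2 hv)).symm

/-- The two tables have equal column sums by `hu'`, and the row `φ v` has the same length in both by
`hu`; nestedness then makes the supports of this row comparable. -/
theorem exists_matching_child (hφ : IsComposition φ) (hα : IsQuotient φ α) (hψ : IsComposition ψ)
    (hβ : ∀ w, β (ψ w) = α (φ w)) {u u' : T} (hu : φ u = φ u') (hu' : ψ (σ u) = ψ (σ' u'))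
    (hA : ∀ v, u ⋖ v → Equivalent (restrict φ v) (restrict φ (σ v)))
    (hA' : ∀ v, u' ⋖ v → Equivalent (restrict φ v) (restrict φ (σ' v)))
    (ht : ZeroOneTable (children u) φ (ψ ∘ σ) β) (hn : NestedTable (children u) φ (ψ ∘ σ) β)
    (ht' : ZeroOneTable (children u') φ (ψ ∘ σ') β)
    (hn' : NestedTable (children u') φ (ψ ∘ σ') β) {v : T} (hv : u ⋖ v) :
    ∃ v', u' ⋖ v' ∧ φ v = φ v' ∧ ψ (σ v) = ψ (σ' v') := by
  classical
  have hcol : ∀ y, #{v ∈ children u | (ψ ∘ σ) v = y} = #{v ∈ children u' | (ψ ∘ σ') v = y} := by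
    intro y
    rw [card_column_comp, card_column_comp]
    exact (hψ.labelIso_of_eq hu').card_children y
  have hsub := row_subset_row ht hn ht' hn' hcol (x := φ v) (x' := φ v) (by
    intro w hw w' hw' hwv hwv'
    rw [mem_children] at hw hw'
    change β (ψ (σ w)) = β (ψ (σ' w'))
    have hσw : σ u ⋖ σ w := (apply_covBy_apply_iff σ).2 hw
    have hσw' : σ' u' ⋖ σ' w' := (apply_covBy_apply_iff σ').2 hw'
    -- `σ' w'` need not be a sibling of `σ w`; it is replaced by a child `z` of `σ u` in the same
    -- column, so that `IsQuotient.eq_of_equivalent` applies.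
    obtain ⟨z, hz, hzw⟩ := hψ.exists_child (hu' ▸ hψ.map_child _ _ hσw')
    rw [← hzw, hβ, hβ]
    refine hα.eq_of_equivalent hφ hσw hz ?_
    refine (hA w hw).symm.trans ?_
    refine (hφ.labelIso_of_eq (hwv.trans hwv'.symm)).equivalent.trans ?_
    refine (hA' w' hw').trans (hα.equivalent_of_eq hφ ?_)
    rw [← hβ, ← hβ, hzw]) ((hφ.labelIso_of_eq hu).card_children _).le
  obtain ⟨v', hv', hvv'⟩ := mem_image.1
    (hsub (mem_image_of_mem _ (mem_filter.2 ⟨mem_children.2 hv, rfl⟩)))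
  rw [mem_filter, mem_children] at hv'
  exact ⟨v', hv'.1, hv'.2.symm, hvv'.symm⟩

theorem labelIso_of_nested (hφ : IsComposition φ) (hα : IsQuotient φ α) (hψ : IsComposition ψ)
    (hβ : ∀ w, β (ψ w) = α (φ w)) {u u' : T} (hu : φ u = φ u') (hu' : ψ (σ u) = ψ (σ' u'))
    (hA : ∀ v, u ⋖ v → Equivalent (restrict φ v) (restrict φ (σ v)))
    (hA' : ∀ v, u' ⋖ v → Equivalent (restrict φ v) (restrict φ (σ' v)))
    (ht : ZeroOneTable (children u) φ (ψ ∘ σ) β) (hn : NestedTable (children u) φ (ψ ∘ σ) β)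
    (ht' : ZeroOneTable (children u') φ (ψ ∘ σ') β)
    (hn' : NestedTable (children u') φ (ψ ∘ σ') β)
    (hB : ∀ v v', u ⋖ v → u' ⋖ v' → φ v = φ v' → ψ (σ v) = ψ (σ' v') →
      LabelIso (fun x => (φ x, (ψ ∘ σ) x)) (fun x => (φ x, (ψ ∘ σ') x)) v v') :
    LabelIso (fun x => (φ x, (ψ ∘ σ) x)) (fun x => (φ x, (ψ ∘ σ') x)) u u' := by
  have h1 : ∀ v : {v // u ⋖ v}, ∃ v' : {v // u' ⋖ v}, φ v.1 = φ v'.1 ∧ ψ (σ v.1) = ψ (σ' v'.1) := by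
    intro v
    obtain ⟨v', hv', h⟩ := exists_matching_child hφ hα hψ hβ hu hu' hA hA' ht hn ht' hn' v.2
    exact ⟨⟨v', hv'⟩, h⟩
  choose f hf hf' using h1
  have hfb : Function.Bijective f := by
    constructor
    · intro v w hvw
      refine Subtype.ext (ht.eq_of_eq _ (mem_children.2 v.2) _ (mem_children.2 w.2) ?_ ?_)
      · rw [hf, hf, hvw]
      · change ψ (σ v.1) = ψ (σ w.1)
        rw [hf', hf', hvw]
    · intro v'
      obtain ⟨v, hv, h1, h2⟩ :=
        exists_matching_child hφ hα hψ hβ hu.symm hu'.symm hA' hA ht' hn' ht hn v'.2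
      refine ⟨⟨v, hv⟩, Subtype.ext
        (ht'.eq_of_eq _ (mem_children.2 (f _).2) _ (mem_children.2 v'.2) ?_ ?_)⟩
      · rw [← hf, h1]
      · change ψ (σ' (f ⟨v, hv⟩).1) = ψ (σ' v'.1)
        rw [← hf', h2]
  refine LabelIso.glue ?_ (Equiv.ofBijective f hfb) fun v => ?_
  · exact Prod.ext hu hu'
  · exact hB v.1 (f v).1 v.2 (f v).2 (hf v) (hf' v)

/-- The uniqueness of rigid pairs. -/
theorem equivalent_and_labelIso_of_rigid (hφ : IsComposition φ) (hα : IsQuotient φ α)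
    (hψ : IsComposition ψ) (hβ : ∀ w, β (ψ w) = α (φ w)) (hc : ConjugateFibers φ ψ β)
    (hid : RigidPair φ ψ) (n : ℕ) :
    (∀ σ : T ≃o T, RigidPair φ (ψ ∘ σ) → ∀ u, Nat.card (Set.Ici u) = n →
      Equivalent (restrict φ u) (restrict φ (σ u))) ∧
    (∀ σ σ' : T ≃o T, RigidPair φ (ψ ∘ σ) → RigidPair φ (ψ ∘ σ') → ∀ u u',
      Nat.card (Set.Ici u) = n → φ u = φ u' → ψ (σ u) = ψ (σ' u') →
      LabelIso (fun x => (φ x, (ψ ∘ σ) x)) (fun x => (φ x, (ψ ∘ σ') x)) u u') := by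
  induction n using Nat.strong_induction_on with
  | _ n ih =>
    have hA : ∀ σ : T ≃o T, RigidPair φ (ψ ∘ σ) → ∀ u, Nat.card (Set.Ici u) = n → ∀ v, u ⋖ v →
        Equivalent (restrict φ v) (restrict φ (σ v)) := by
      intro σ hσ u hu v hv
      exact (ih _ (hu ▸ card_Ici_lt hv)).1 σ hσ v rfl
    have hB : ∀ σ σ' : T ≃o T, RigidPair φ (ψ ∘ σ) → RigidPair φ (ψ ∘ σ') → ∀ u,
        Nat.card (Set.Ici u) = n → ∀ v v', u ⋖ v → φ v = φ v' → ψ (σ v) = ψ (σ' v') →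
        LabelIso (fun x => (φ x, (ψ ∘ σ) x)) (fun x => (φ x, (ψ ∘ σ') x)) v v' := by
      intro σ σ' hσ hσ' u hu v v' hv
      exact (ih _ (hu ▸ card_Ici_lt hv)).2 σ σ' hσ hσ' v v' rfl
    have ht : ∀ σ : T ≃o T, RigidPair φ (ψ ∘ σ) → ∀ u, Nat.card (Set.Ici u) = n →
        ZeroOneTable (children u) φ (ψ ∘ σ) β := fun σ hσ u hu =>
      zeroOneTable_of_rigid hφ hα hβ hσ (hA σ hσ u hu)
        fun v v' hv _ => hB σ σ hσ hσ u hu v v' hv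
    have hcardσ : ∀ (σ : T ≃o T) (u : T), Nat.card (Set.Ici (σ u)) = Nat.card (Set.Ici u) :=
      fun σ u => (card_Ici_congr (subtreeIsoOfIso σ u)).symm
    have hn : ∀ σ : T ≃o T, RigidPair φ (ψ ∘ σ) → ∀ u, Nat.card (Set.Ici u) = n →
        NestedTable (children u) φ (ψ ∘ σ) β := by
      intro σ hσ u hu
      refine (card_siblingPairs_le hψ hc (ht σ hσ u hu)).2 ?_
      -- The inequality holds at every vertex with a subtree of size `n`, and `σ` permutes these
      -- vertices.
      exact apply_eq_of_le_perm σ.toEquiv (p := fun u => Nat.card (Set.Ici u) = n)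
        (g := fun u => #(siblingPairs φ u)) (fun x => by
          change Nat.card (Set.Ici (σ x)) = n ↔ _
          rw [hcardσ]) (fun x hx => (card_siblingPairs_le hψ hc (ht σ hσ x hx)).1) hu
    refine ⟨fun σ hσ u hu => ?_, fun σ σ' hσ hσ' u u' hu h1 h2 => ?_⟩
    · have hσu : Nat.card (Set.Ici (σ u)) = n := (hcardσ σ u).trans hu
      -- At `σ u` the reference table is that of the rigid pair `(φ, ψ)`, the case of the identity
      -- automorphism.
      exact equivalent_of_nested hφ hα hβ (hA σ hσ u hu) (ht σ hσ u hu) (hn σ hσ u hu)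
        (ht (OrderIso.refl T) hid _ hσu) (hn (OrderIso.refl T) hid _ hσu)
    · have hu' : Nat.card (Set.Ici u') = n := by
        obtain ⟨h, -⟩ := hφ.labelIso_of_eq h1
        rw [← hu, card_Ici_congr h]
      exact labelIso_of_nested hφ hα hψ hβ h1 h2 (hA σ hσ u hu) (hA σ' hσ' u' hu')
        (ht σ hσ u hu) (hn σ hσ u hu) (ht σ' hσ' u' hu') (hn σ' hσ' u' hu')
        fun v v' hv _ => hB σ σ' hσ hσ' u hu v v' hv

theorem exists_iso_of_rigid (hφ : IsComposition φ) (hα : IsQuotient φ α)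
    (hψ : IsComposition ψ) (hβ : ∀ w, β (ψ w) = α (φ w)) (hc : ConjugateFibers φ ψ β)
    (hid : RigidPair φ ψ) (hσ : RigidPair φ (ψ ∘ σ)) :
    ∃ h : T ≃o T, ∀ x, φ x = φ (h x) ∧ ψ (σ x) = ψ (h x) := by
  obtain ⟨h, hh⟩ := (equivalent_and_labelIso_of_rigid hφ hα hψ hβ hc hid _).2 σ (OrderIso.refl T)
    hσ hid ⊥ ⊥ rfl rfl (by simp)
  let e : T ≃o Set.Ici (⊥ : T) :=
    { toFun := fun x => ⟨x, bot_le⟩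
      invFun := fun x => x
      left_inv := fun _ => rfl
      right_inv := fun _ => rfl
      map_rel_iff' := Iff.rfl }
  refine ⟨(e.trans h).trans e.symm, fun x => ?_⟩
  have := hh ⟨x, bot_le⟩
  exact ⟨congrArg Prod.fst this, congrArg Prod.snd this⟩

end Uniqueness

/-! ### Consequences of the transpose conditions. -/

section Transposes

variable {T P M Q : Type*} [PartialOrder T] [OrderBot T] [PartialOrder P] [OrderBot P]
  [PartialOrder M] [OrderBot M] [PartialOrder Q] [OrderBot Q] {φ : T →o P} {ψ : T →o M}
  {α : P →o Q} {β : M →o Q}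

open scoped Classical in
theorem sum_map_partitionAt [Finite T] [Finite P] (φ : T →o P) (α : P →o Q) (u : T) (b : Q)
    (f : ℕ → ℕ) : ((partitionAt φ α u b).map f).sum =
      ∑ x ∈ children (φ u) with α x = b, f #{v ∈ children u | φ v = x} := by
  rw [partitionAt, Multiset.map_map, Finset.sum_eq_multiset_sum]
  have h1 : (Set.toFinite {y : P | φ u ⋖ y ∧ α y = b}).toFinset =
      {x ∈ children (φ u) | α x = b} := by
    ext x
    simp
  rw [h1]
  congr 1
  refine Multiset.map_congr rfl fun x _ => ?_
  have h2 : {w : T | u ⋖ w ∧ φ w = x} = ({v ∈ children u | φ v = x} : Finset T) := by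
    ext v
    simp
  rw [Function.comp_apply, h2, Set.ncard_coe_finset]

open scoped Classical in
theorem card_siblingPairs [Finite T] [Finite P] (hφ : IsComposition φ) (w : T) :
    #(siblingPairs φ w) = ∑ x ∈ children (φ w), #{v ∈ children w | φ v = x} ^ 2 := by
  rw [siblingPairs, Finset.card_eq_sum_card_fiberwise (t := children (φ w)) (f := fun p => φ p.1)]
  · refine Finset.sum_congr rfl fun x _ => ?_
    rw [sq, ← card_product]
    congr 1
    ext ⟨p, q⟩
    simp only [mem_filter, mem_product]
    constructor
    · rintro ⟨⟨⟨h1, h2⟩, h3⟩, h4⟩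
      exact ⟨⟨h1, h4⟩, h2, h3.symm.trans h4⟩
    · rintro ⟨⟨h1, h4⟩, h2, h3⟩
      exact ⟨⟨⟨h1, h2⟩, h4.trans h3.symm⟩, h4⟩
  · intro p hp
    simp only [coe_filter, mem_product, Set.mem_ofPred_eq, mem_children, mem_coe] at hp ⊢
    exact hφ.map_child _ _ hp.1.1

/-- Both sides split over the children `b` of `α (φ w)`, and each summand is `sum_sq_rowLens` for `Λ
b`. -/
theorem conjugateFibers_of_transpose [Finite T] [Finite P] [Finite M] [Finite Q]
    (hφ : IsComposition φ) (hα : IsComposition α) (hβ : IsComposition β)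
    (hβα : ∀ w, β (ψ w) = α (φ w)) {Λ : Q → YoungDiagram} (hΛ : IsTreeOfPartitions φ α Λ)
    (hΛ' : IsTreeOfPartitions ψ β fun b => (Λ b).transpose) : ConjugateFibers φ ψ β := by
  classical
  intro w
  rw [card_siblingPairs hφ, ← Finset.sum_fiberwise_of_maps_to (t := children (α (φ w))) (g := α)
    (fun x hx => mem_children.2 (hα.map_child _ _ (mem_children.1 hx))),
    ← Finset.sum_fiberwise_of_maps_to (t := children (α (φ w))) (g := fun q : M × M => β q.1)
    (fun q hq => by
      rw [mem_filter, mem_product, mem_children] at hq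
      rw [mem_children, ← hβα]
      exact hβ.map_child _ _ hq.1.1)]
  refine Finset.sum_congr rfl fun b hb => ?_
  rw [mem_children] at hb
  have h1 := sum_sq_rowLens (Λ b)
  rw [hΛ w b hb, hΛ' w b ((hβα w).symm ▸ hb), sum_map_partitionAt, sum_map_partitionAt] at h1
  simp only [sum_map_partitionAt] at h1
  rw [h1, ← Finset.sum_product' (f := fun y z =>
    min #{v ∈ children w | ψ v = y} #{v ∈ children w | ψ v = z})]
  refine Finset.sum_congr ?_ fun _ _ => rfl
  ext ⟨y, z⟩
  simp only [mem_filter, mem_product]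
  constructor
  · rintro ⟨⟨h1, h2⟩, h3, h4⟩
    exact ⟨⟨⟨h1, h3⟩, h2.trans h4.symm⟩, h2⟩
  · rintro ⟨⟨⟨h1, h3⟩, h4⟩, h2⟩
    exact ⟨⟨h1, h2⟩, h3, h4.symm.trans h2⟩

theorem ZeroOneIntersection.eq_of_eq [Finite T] (h : ZeroOneIntersection φ ψ)
    (hφ : IsComposition φ) (hψ : IsComposition ψ) {u v : T} (h1 : φ u = φ v) (h2 : ψ u = ψ v) :
    u = v := by
  by_cases hu : u = ⊥
  · subst hu
    by_contra hv
    rw [hφ.map_bot] at h1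
    exact hφ.ne_bot (Ne.symm hv) h1.symm
  · obtain ⟨p, hp⟩ := exists_parent hu
    exact Set.encard_le_one_iff.1
      (h p (φ u) (ψ u) ⟨u, hp⟩ (hφ.map_child _ _ hp) (hψ.map_child _ _ hp)) u v ⟨rfl, rfl⟩
      ⟨h1.symm, h2.symm⟩

theorem ZeroOneIntersection.rigidPair [Finite T] (h : ZeroOneIntersection φ ψ)
    (hφ : IsComposition φ) (hψ : IsComposition ψ) : RigidPair φ ψ := by
  intro u v _ huv
  exact h.eq_of_eq hφ hψ (congrArg Prod.fst huv.label_eq) (congrArg Prod.snd huv.label_eq)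

end Transposes

/-! ### Trivial refinements and rigidity. -/

section Refinements

variable {T P M R : Type*} [PartialOrder T] [OrderBot T] [PartialOrder P] [OrderBot P]
  [PartialOrder M] [OrderBot M] [PartialOrder R] [OrderBot R] {φ : T →o P} {ψ : T →o M}
  {ρ : T →o R} {θ : R →o P} {τ : R →o M}

theorem isComposition_of_iso (e : T ≃o R) : IsComposition (e : T →o R) := by
  have hcov : ∀ u v, e u ⋖ e v ↔ u ⋖ v := fun u v => apply_covBy_apply_iff e
  constructor
  · exact e.map_bot
  · exact fun u v h => (hcov u v).2 h
  · intro u hu w hw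
    obtain ⟨v, rfl⟩ := e.surjective w
    exact hu v ((hcov u v).1 hw)
  · exact e.surjective
  · intro u v _ _ _ h
    obtain rfl := e.injective h
    exact LabelIso.refl _ _

/-- An injective composition is an isomorphism. -/
theorem IsComposition.isTrivial [Finite T] [PredOrder R] (h : IsComposition ρ)
    (hinj : Function.Injective ρ) : IsTrivial ρ := by
  have hle : ∀ x y, ρ x ≤ ρ y ↔ x ≤ y := by
    refine fun x y => ⟨fun hxy => ?_, fun hxy => ρ.monotone hxy⟩
    induction y using WellFoundedLT.induction with
    | ind y ih =>
      by_cases hne : ρ x = ρ y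
      · exact (hinj hne).le
      · have hy : y ≠ ⊥ := by
          rintro rfl
          rw [h.map_bot, le_bot_iff] at hxy
          exact hne (by rw [hxy, h.map_bot])
        obtain ⟨p, hp⟩ := exists_parent hy
        refine (ih p hp.lt ?_).trans hp.le
        have hp' := h.map_child _ _ hp
        have h1 : ρ x ≤ Order.pred (ρ y) := Order.le_pred_of_lt (lt_of_le_of_ne hxy hne)
        have h2 : Order.pred (ρ y) < ρ y :=
          Order.pred_lt_of_not_isMin fun hmin => hmin.not_lt hp'.lt
        have h3 : ρ p ≤ Order.pred (ρ y) := Order.le_pred_of_lt hp'.lt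
        rcases h3.lt_or_eq with h4 | h4
        · exact absurd h2 (hp'.2 h4)
        · rwa [h4]
  exact ⟨RelIso.ofSurjective (OrderEmbedding.ofMapLEIff ρ hle) h.surjective, fun _ => rfl⟩

/-- When `ρ` is an isomorphism, a labelled isomorphism `ζ` between sibling subtrees transports
through `ρ` to the targets, giving an equivalence of restricted refinements that coarseness forbids.
-/
theorem IsCoarsestCommonRefinement.rigidPair (h : IsCoarsestCommonRefinement φ ψ ρ θ τ)
    (htriv : IsTrivial ρ) : RigidPair φ ψ := by
  obtain ⟨e, he⟩ := htriv
  have hl : ∀ w, θ (ρ w) = φ w := fun w => by rw [← h.isCommonRefinement.comm_left]; rfl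
  have hr : ∀ w, τ (ρ w) = ψ w := fun w => by rw [← h.isCommonRefinement.comm_right]; rfl
  rintro u v ⟨p, hu, hv⟩ huv
  by_contra hne
  have hch := h.isCommonRefinement.comp_ρ.map_child
  refine h.coarse u v ⟨ρ p, hch _ _ hu, hch _ _ hv⟩ (fun heq => hne ?_) ?_ ?_ ?_
  · rw [← he, ← he] at heq
    exact e.injective heq
  · rw [hl, hl]; exact congrArg Prod.fst huv.label_eq
  · rw [hr, hr]; exact congrArg Prod.snd huv.label_eq
  · obtain ⟨ζ, hζ⟩ := huv
    have hue : e u = ρ u := he u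
    have hve : e v = ρ v := he v
    let a : ∀ x, Set.Ici x ≃o Set.Ici (ρ x) := fun x =>
      (subtreeIsoOfIso e x).trans (OrderIso.setCongr _ _ (by rw [he]))
    have ha : ∀ x (y : Set.Ici x), (a x y : R) = ρ y := fun x y => he y
    have hγ : ∀ y : Set.Ici u, ((((a u).symm.trans ζ).trans (a v)) (a u y) : R) = ρ (ζ y) := by
      intro y
      simp [ha]
    refine ⟨ζ, ((a u).symm.trans ζ).trans (a v), fun w => ?_,
      fun w => congrArg Prod.fst (hζ w), fun w => congrArg Prod.snd (hζ w), fun b => ?_,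
      fun b => ?_⟩
    · have h1 : restrict ρ u w = a u w := Subtype.ext (ha u w).symm
      rw [h1]
      exact Subtype.ext (hγ w)
    · obtain ⟨w, rfl⟩ := (a u).surjective b
      change θ (a u w : R) = θ ((((a u).symm.trans ζ).trans (a v)) (a u w) : R)
      rw [hγ, ha, hl, hl]
      exact congrArg Prod.fst (hζ w)
    · obtain ⟨w, rfl⟩ := (a u).surjective b
      change τ (a u w : R) = τ ((((a u).symm.trans ζ).trans (a v)) (a u w) : R)
      rw [hγ, ha, hr, hr]
      exact congrArg Prod.snd (hζ w)

end Refinements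

end TreeComposition

/-! ### The theorem. -/

theorem mainTheorem11
    (T : RootedTree.{uT}) (P : RootedTree.{uP}) (Pt : RootedTree.{uPt}) (Q : RootedTree.{uQ})
    (R : RootedTree.{uR}) [Finite T] [Finite P] [Finite Pt] [Finite Q] [Finite R]
    (φ : T →o P) (hφ : TreeComposition.IsComposition φ)
    (α : P →o Q) (hα : TreeComposition.IsQuotient φ α)
    (Λ : Q → YoungDiagram) (hΛ : TreeComposition.IsTreeOfPartitions φ α Λ)
    (φt : T →o Pt) (hφt : TreeComposition.IsTranspose φ α Λ φt)
    (ψ : T →o Pt) (hψ : TreeComposition.IsComposition ψ)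
    (hψφt : TreeComposition.StrictlyEquivalent ψ φt)
    (ρ : T →o R) (θ : R →o P) (τ : R →o Pt)
    (hρ : TreeComposition.IsCoarsestCommonRefinement φ ψ ρ θ τ)
    (htriv : TreeComposition.IsTrivial ρ) :
    (∃ g : T ≃o T, TreeComposition.act g φ = φ ∧ TreeComposition.act g φt = ψ) ∧
    TreeComposition.PairStrictlyEquivalent φ ψ φ φt ∧
    (∃ (S : RootedTree.{uR}) (ρ' : T →o S) (θ' : S →o P) (τ' : S →o Pt),
      TreeComposition.IsCoarsestCommonRefinement φ φt ρ' θ' τ') ∧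
    (∀ (S : RootedTree.{uS}) (ρ' : T →o S) (θ' : S →o P) (τ' : S →o Pt),
      TreeComposition.IsCoarsestCommonRefinement φ φt ρ' θ' τ' →
        TreeComposition.RefinementsEquivalent φ ψ ρ θ τ φ φt ρ' θ' τ') := by
  open TreeComposition in
  obtain ⟨σ, hσ⟩ := hψφt
  obtain ⟨-, -, hcomp, ⟨β, hβ, hβα, hΛ'⟩, h01⟩ := hφt
  have hβα' : ∀ w, β (φt w) = α (φ w) := fun w => DFunLike.congr_fun hβα w
  have hrigid : RigidPair φ (φt ∘ σ) := by
    have h1 := hρ.rigidPair htriv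
    rwa [show (ψ : T → Pt) = φt ∘ σ from funext hσ] at h1
  obtain ⟨h, hh⟩ := exists_iso_of_rigid hφ hα hcomp hβα'
    (conjugateFibers_of_transpose hφ hα.isComposition hβ.isComposition hβα' hΛ hΛ')
    (h01.rigidPair hφ hcomp) hrigid
  have hψh : ∀ w, ψ w = φt (h w) := fun w => (hσ w).trans (hh w).2
  have hφh : ∀ w, φ w = φ (h w) := fun w => (hh w).1
  have hl : ∀ w, θ (ρ w) = φ w := fun w => by rw [← hρ.isCommonRefinement.comm_left]; rfl
  have hr : ∀ w, τ (ρ w) = ψ w := fun w => by rw [← hρ.isCommonRefinement.comm_right]; rfl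
  obtain ⟨e, he⟩ := htriv
  -- The action composes with the inverse, hence `g = h⁻¹`. Precomposing `ρ` with `h⁻¹` turns a
  -- refinement of `(φ, ψ)` into one of `(φ, φt)`.
  refine ⟨⟨h.symm, ?_, ?_⟩, ⟨h, hφh, hψh⟩, ⟨R, ((h.symm.trans e : T ≃o R) : T →o R), θ, τ, ?_⟩, ?_⟩
  · exact OrderHom.ext _ _ (funext fun w => (hφh w).symm)
  · exact OrderHom.ext _ _ (funext fun w => (hψh w).symm)
  · have hl' : ∀ w, θ (e (h.symm w)) = φ w := fun w => by rw [he, hl, hφh]; simp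
    have hr' : ∀ w, τ (e (h.symm w)) = φt w := fun w => by rw [he, hr, hψh]; simp
    refine ⟨⟨isComposition_of_iso _, hρ.isCommonRefinement.comp_θ, hρ.isCommonRefinement.comp_τ,
      OrderHom.ext _ _ (funext hl'), OrderHom.ext _ _ (funext hr')⟩, ?_⟩
    intro u v _ hne h1 h2
    refine absurd (congrArg _ (h01.eq_of_eq hφ hcomp ?_ ?_)) hne
    · rw [← hl', ← hl']; exact h1
    · rw [← hr', ← hr']; exact h2
  · intro S ρ' θ' τ' hρ'
    have hl' : ∀ w, θ' (ρ' w) = φ w := fun w => by rw [← hρ'.isCommonRefinement.comm_left]; rfl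
    have hr' : ∀ w, τ' (ρ' w) = φt w := fun w => by rw [← hρ'.isCommonRefinement.comm_right]; rfl
    -- `φ` and `φt` together separate all the vertices of `T`, so any common refinement of them is
    -- injective, hence an isomorphism.
    obtain ⟨e', he'⟩ := hρ'.isCommonRefinement.comp_ρ.isTrivial fun u v huv =>
      h01.eq_of_eq hφ hcomp (by rw [← hl', ← hl', huv]) (by rw [← hr', ← hr', huv])
    refine ⟨h, (e.symm.trans h).trans e', fun w => ?_, hφh, hψh, fun a => ?_, fun a => ?_⟩
    · rw [← he, ← he']; simp
    · obtain ⟨w, rfl⟩ := e.surjective a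
      rw [he, hl, ← he]
      simp [he', hl', ← hφh]
    · obtain ⟨w, rfl⟩ := e.surjective a
      rw [he, hr, ← he]
      simp [he', hr', ← hψh]
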